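/- Let $A,C,\hat P,W,X_0\in\mathbb R^{m\times m}$, $B\in\mathbb R^{m\times u}$, $K\in\mathbb R^{u\times m}$ and $\Delta>0$, with $W\succ0$, $\hat P\succ 0$, $X_0\succeq 0$. Put $\hat P_+=A\hat PA^{\mathrm T}+W$ and suppose that $\hat P^{-1}-\hat P_+^{-1}=\frac{12}{\Delta^2}C^{\mathrm T}C$. Let $J=\hat P_+C^{\mathrm T}\left(C\hat P_+C^{\mathrm T}+\frac{\Delta^2}{12}I_m\right)^{-1}$, $L=AJ$, $R=A-LC$. Let $Q_\Delta:\mathbb R^m\to\Delta\mathbb Z^m$ be the uniform quantizer, $[Q_\Delta(x)]_i=k\Delta$ if $[x]_i\in[k\Delta-\Delta/2,k\Delta+\Delta/2)$. Let $\mathbf x_0\sim\mathcal N(0,X_0)$, let $\mathbf w_0,\mathbf w_1,\dots$ have law $\mathcal N(0,W)$, and let $\mathbf d_0,\mathbf d_1,\dots$ be random vectors in $\mathbb R^m$ with independent components, each uniform on $[-\Delta/2,\Delta/2]$; assume that all of $\mathbf x_0,\mathbf w_0,\mathbf w_1,\dots,\mathbf d_0,\mathbf d_1,\dots$ are mutually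 independent. Consider the closed loop defined for $t\ge 0$ by $\overline{\mathbf x}_{0|-1}=0$ and $$\mathbf e_t=\mathbf x_t-\overline{\mathbf x}_{t|t-1},\quad \mathbf q_t=Q_\Delta(C\mathbf e_t+\mathbf d_t),\quad \mathbf y_t=(\mathbf q_t-\mathbf d_t)+C\overline{\mathbf x}_{t|t-1},\quad \overline{\mathbf x}_{t|t}=\overline{\mathbf x}_{t|t-1}+J(\mathbf y_t-C\overline{\mathbf x}_{t|t-1}),$$ $$\mathbf u_t=K\overline{\mathbf x}_{t|t},\quad \mathbf x_{t+1}=A\mathbf x_t+B\mathbf u_t+\mathbf w_t,\quad \overline{\mathbf x}_{t+1|t}=A\overline{\mathbf x}_{t|t}+B\mathbf u_t .$$ The pairs $(\mathbf e_t,\mathbf d_t)$ form a Markov chain that moves from $(e,d)$ to $(M(e,d)+\mathbf w,\mathbf d')$, where $M(e,d)=Re-L\left(Q_\Delta(Ce+d)-d-Ce\right)$, $\mathbf w\sim\mathcal N(0,W)$, and $\mathbf d'$ is independent of $\mathbf w$ and distributed as $\mathbf d_0$. Then this chain has an invariant probability law with a density that is positive everywhere on $\mathbb R^m\times[-\Delta/2,\Delta/2]^m$.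 Moreover, if $(\mathbf e,\mathbf d)$ follows an invariant probability law of the chain and $\mathbf q=Q_\Delta(C\mathbf e+\mathbf d)$, then $$D_{\mathrm{KL}}(\mathbf q_t\,\|\,\mathbf q)<\infty\ \text{ for every } t\ge 0,\qquad \lim_{t\to\infty}D_{\mathrm{KL}}(\mathbf q_t\,\|\,\mathbf q)=0 .$$ -/

import Mathlib

open MeasureTheory ProbabilityTheory Filter Topology
open scoped ENNReal Matrix

/-- Euclidean space `ℝ^m`. -/
abbrev Vec (m : ℕ) : Type := EuclideanSpace ℝ (Fin m)

namespace DitheredLQG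

/-- The matrix-vector product `A x`, as a vector of Euclidean space. -/
noncomputable def mv {k m : ℕ} (A : Matrix (Fin k) (Fin m) ℝ) (x : Vec m) : Vec k :=
  WithLp.toLp 2 (A *ᵥ x.ofLp)

/-- The uniform elementwise quantizer with step `Δ`: the `i`-th entry of the output is `k Δ`, where
`k` is the integer such that `k Δ - Δ/2 ≤ x i < k Δ + Δ/2`. -/
noncomputable def quantize {m : ℕ} (Δ : ℝ) (x : Vec m) : Vec m :=
  WithLp.toLp 2 fun i => (⌊x i / Δ + 1 / 2⌋ : ℝ) * Δ

/-- The defining property of the quantizer. -/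
theorem quantize_apply_eq_iff {m : ℕ} {Δ : ℝ} (hΔ : 0 < Δ) (x : Vec m) (i : Fin m) (k : ℤ) :
    quantize Δ x i = k * Δ ↔ x i ∈ Set.Ico (k * Δ - Δ / 2) (k * Δ + Δ / 2) := by
  have h : quantize Δ x i = (⌊x i / Δ + 1 / 2⌋ : ℝ) * Δ := rfl
  rw [h, mul_left_inj' hΔ.ne', Int.cast_inj, Int.floor_eq_iff, Set.mem_Ico]
  have e : x i = x i / Δ * Δ := by field_simp
  constructor
  · rintro ⟨h1, h2⟩
    constructor <;> rw [e] <;> nlinarith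
  · rintro ⟨h1, h2⟩
    rw [e] at h1 h2
    constructor
    · by_contra hc
      push Not at hc
      nlinarith
    · by_contra hc
      push Not at hc
      nlinarith

@[fun_prop]
theorem measurable_mv {k m : ℕ} (A : Matrix (Fin k) (Fin m) ℝ) : Measurable (mv A) := by
  have : mv A = fun x => Matrix.toEuclideanLin A x := rfl
  rw [this]
  exact (LinearMap.continuous_of_finiteDimensional _).measurable

@[fun_prop]
theorem measurable_quantize {m : ℕ} (Δ : ℝ) : Measurable (quantize Δ : Vec m → Vec m) := by
  refine (WithLp.measurable_toLp 2 (Fin m → ℝ)).comp (measurable_pi_lambda _ fun i => ?_)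
  have h : Measurable fun x : Vec m => x i := by fun_prop
  exact ((measurable_from_top (f := fun n : ℤ => (n : ℝ))).comp
    (Int.measurable_floor.comp ((h.div_const Δ).add_const (1 / 2)))).mul_const Δ

/-- The cube `{x | ‖x‖_∞ ≤ Δ / 2}`. -/
def cube (m : ℕ) (Δ : ℝ) : Set (Vec m) := {x | ∀ i, |x i| ≤ Δ / 2}

/-- The law of the dither: independent coordinates, each uniform on `[-Δ/2, Δ/2]`. -/
noncomputable def ditherLaw (m : ℕ) (Δ : ℝ) : Measure (Vec m) :=
  (Measure.pi fun _ : Fin m => (volume : Measure ℝ)[|Set.Icc (-(Δ / 2)) (Δ / 2)]).map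
    (WithLp.toLp 2)

/-- The data of the control architecture: the plant matrices `A`, `B`, the covariance `W` of the
process noise, the feedback gain `K`, the quantizer step `Δ`, the measurement matrix `C`, and the
(asymptotic) posterior error covariance `Phat` of the Kalman filter. -/
structure Design (m n : ℕ) where
  A : Matrix (Fin m) (Fin m) ℝ
  B : Matrix (Fin m) (Fin n) ℝ
  W : Matrix (Fin m) (Fin m) ℝ
  K : Matrix (Fin n) (Fin m) ℝ
  Δ : ℝ
  C : Matrix (Fin m) (Fin m) ℝ
  Phat : Matrix (Fin m) (Fin m) ℝ

namespace Design

variable {m n : ℕ} (S : Design m n)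

/-- The prediction error covariance `A Phat Aᵀ + W`. -/
noncomputable def Pplus : Matrix (Fin m) (Fin m) ℝ := S.A * S.Phat * S.Aᵀ + S.W

/-- The time-invariant Kalman gain `J = Pplus Cᵀ (C Pplus Cᵀ + (Δ²/12) I)⁻¹`. -/
noncomputable def J : Matrix (Fin m) (Fin m) ℝ :=
  S.Pplus * S.Cᵀ * (S.C * S.Pplus * S.Cᵀ + (S.Δ ^ 2 / 12) • (1 : Matrix (Fin m) (Fin m) ℝ))⁻¹

/-- `L = A J`. -/
noncomputable def L : Matrix (Fin m) (Fin m) ℝ := S.A * S.J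

/-- `R = A - L C`. -/
noncomputable def R : Matrix (Fin m) (Fin m) ℝ := S.A - S.L * S.C

/-- The quantizer output `Q_Δ(C e + d)`. -/
noncomputable def output (e d : Vec m) : Vec m := quantize S.Δ (mv S.C e + d)

/-- The decoder's posterior estimate, from its prediction `xbar`, the plant state `x` and the
dither `d`: the quantization is `Q_Δ(C (x - xbar) + d)`, the centered measurement is
`y = (Q_Δ(C (x - xbar) + d) - d) + C xbar`, and the estimate is `xbar + J (y - C xbar)`. -/
noncomputable def posterior (x xbar d : Vec m) : Vec m :=
  let y : Vec m := (S.output (x - xbar) d - d) + mv S.C xbar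
  xbar + mv S.J (y - mv S.C xbar)

/-- The closed loop driven by the initial state `x₀`, the process noise `w` and the dither `d`.
The value at time `t` is the pair of the plant state `x_t` and the prediction of `x_t` made by the
Kalman filter from the data received before time `t`. The control is `u_t = K xpost_t`,
where `xpost_t` is the posterior estimate. -/
noncomputable def loop (x₀ : Vec m) (w d : ℕ → Vec m) : ℕ → Vec m × Vec m
  | 0 => (x₀, 0)
  | t + 1 =>
    let x := (loop x₀ w d t).1
    let xpost := S.posterior x (loop x₀ w d t).2 (d t)
    let u : Vec n := mv S.K xpost
    (mv S.A x + mv S.B u + w t, mv S.A xpost + mv S.B u)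

/-- The prediction error `e_t`: the plant state minus its prediction. -/
noncomputable def err (x₀ : Vec m) (w d : ℕ → Vec m) (t : ℕ) : Vec m :=
  (S.loop x₀ w d t).1 - (S.loop x₀ w d t).2

/-- The quantization `q_t = Q_Δ(C e_t + d_t)`. -/
noncomputable def quant (x₀ : Vec m) (w d : ℕ → Vec m) (t : ℕ) : Vec m :=
  S.output (S.err x₀ w d t) (d t)

/-- `M(e, d) = R e - L (Q_Δ(C e + d) - d - C e)`, the noiseless part of one step of the
error recursion. -/
noncomputable def drift (e d : Vec m) : Vec m :=
  mv S.R e - mv S.L (S.output e d - d - mv S.C e)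

@[fun_prop]
theorem measurable_output : Measurable fun z : Vec m × Vec m => S.output z.1 z.2 := by
  unfold output
  fun_prop

@[fun_prop]
theorem measurable_drift : Measurable fun z : Vec m × Vec m => S.drift z.1 z.2 := by
  have h := S.measurable_output
  unfold drift
  fun_prop

/-- The transition kernel of the Markov chain `(e_t, d_t)`: from `(e, d)` the chain moves to
`(M(e, d) + w, d')`, where `w` is Gaussian with mean `0` and covariance `W`, and `d'` is a dither
vector independent of `w`. -/
noncomputable def transition : Kernel (Vec m × Vec m) (Vec m × Vec m) :=
  (Kernel.deterministic (fun z : Vec m × Vec m => S.drift z.1 z.2) S.measurable_drift ×ₖ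
    Kernel.const (Vec m × Vec m) ((multivariateGaussian 0 S.W).prod (ditherLaw m S.Δ))).map
    fun p => (p.1 + p.2.1, p.2.2)

/-- `π` is an invariant law of the chain `(e_t, d_t)`. -/
structure IsInvariantLaw (π : Measure (Vec m × Vec m)) : Prop where
  isProbabilityMeasure : IsProbabilityMeasure π
  invariant : S.transition.Invariant π

/-- The law of `Q_Δ(C e + d)` when `(e, d)` has law `π`. -/
noncomputable def outputLaw (π : Measure (Vec m × Vec m)) : Measure (Vec m) :=
  π.map fun z => S.output z.1 z.2

end Design

end DitheredLQG

/-!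
The dither makes the closed loop linear in law. For every offset `z`, the quantization error
`Q(z + d) - d - z` is uniform on the cube (`map_quantization_error_ditherLaw`), so that along the
chain it is independent of `e_t` and distributed as the dither
(`Design.map_prodMk_quantization_error`). On laws, the error recursion is therefore
`e ↦ R e + ξ`, where `ξ = w - L v` and `v` is a fresh dither vector, and the law of `(e_t, d_t)` is
always the product of the law of `e_t` and the dither law (`Design.map_err_eq_iterate`).

The hypothesis on `Phat` says that `R = A Phat Pplus⁻¹`, which gives the Lyapunov inequality
`R Pplus Rᵀ + W ≤ Pplus`; hence `∑ ‖R ^ k‖ < ∞` (`Design.summable_norm_R_pow`). The series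
`∑ R ^ k ξ_k` then converges in `L²`, and its law is the only law invariant under the recursion
(`exists_unique_invariant_affineStep`). Since `ξ` contains the nondegenerate Gaussian `w`, this law
has a density bounded below by a multiple of a Gaussian one
(`exists_conv_map_stdGaussian_eq_withDensity`). This settles the first assertion.

By the data processing inequality it is enough, for `t ≥ 1`, to bound the divergence between the
law of `e_t` and the invariant one. Both are obtained from the initial laws by applying `R ^ t` and
adding the same noise, whose part `w` costs `‖W^(-1/2) R ^ t (x - y)‖² / 2` for two initial states
`x`, `y` by the Cameron-Martin formula. Averaging over independent initial states gives a bound of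
order `‖R ^ t‖²`, which is finite and tends to zero (`Design.klDiv_iterate_errStep_le`).

For `t = 0` the law of `e_0` may be singular, and only the output law can be compared. The
divergence is then at most one plus the mean of `-log P(q = q_0)`, and `P(q = q_0)` is bounded
below through the invariant mass of a neighbourhood of `(e_0, d_0)` on which the quantizer is
constant. The size of that neighbourhood is governed by the distance of a uniform variable to the
ends of its interval, whose logarithm is integrable (`Design.klDiv_outputLaw_ne_top`).
-/

/-! ### Lebesgue density and translations of the standard Gaussian law -/

namespace DitheredLQG

/-- A product of laws with densities has the product density. -/
theorem pi_withDensity_ofReal {ι : Type*} [Fintype ι] {X : ι → Type*}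
    [∀ i, MeasurableSpace (X i)] (μ : ∀ i, Measure (X i)) [∀ i, SigmaFinite (μ i)]
    {g : ∀ i, X i → ℝ} (hg : ∀ i x, 0 ≤ g i x) (hint : ∀ i, Integrable (g i) (μ i)) :
    Measure.pi (fun i => (μ i).withDensity fun x => ENNReal.ofReal (g i x)) =
      (Measure.pi μ).withDensity fun x => ENNReal.ofReal (∏ i, g i (x i)) := by
  have hfin : ∀ i, IsFiniteMeasure ((μ i).withDensity fun x => ENNReal.ofReal (g i x)) := fun i =>
    isFiniteMeasure_withDensity_ofReal (hint i).2
  refine Measure.pi_eq fun s hs => ?_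
  rw [withDensity_apply _ (MeasurableSet.univ_pi hs), Measure.restrict_pi_pi,
    ← ofReal_integral_eq_lintegral_ofReal, integral_fintype_prod_eq_prod,
    ENNReal.ofReal_prod_of_nonneg]
  · refine Finset.prod_congr rfl fun i _ => ?_
    rw [withDensity_apply _ (hs i), ofReal_integral_eq_lintegral_ofReal (hint i).restrict]
    exact ae_of_all _ (hg i)
  · exact fun i _ => integral_nonneg (hg i)
  · exact Integrable.fintype_prod_dep fun i => (hint i).restrict
  · exact ae_of_all _ fun x => Finset.prod_nonneg fun i _ => hg i _

/-- The Lebesgue density of the standard Gaussian law on `ℝ^m`. -/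
noncomputable def stdGaussianPDF (m : ℕ) (z : Vec m) : ℝ :=
  (√(2 * Real.pi))⁻¹ ^ m * Real.exp (-(‖z‖ ^ 2 / 2))

theorem stdGaussianPDF_pos (m : ℕ) (z : Vec m) : 0 < stdGaussianPDF m z := by
  unfold stdGaussianPDF; positivity

@[fun_prop]
theorem measurable_stdGaussianPDF (m : ℕ) : Measurable (stdGaussianPDF m) := by
  unfold stdGaussianPDF; fun_prop

theorem stdGaussian_eq_withDensity (m : ℕ) :
    stdGaussian (Vec m) = volume.withDensity fun z => ENNReal.ofReal (stdGaussianPDF m z) := by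
  rw [← map_pi_eq_stdGaussian]
  have h1 : gaussianReal 0 1 =
      volume.withDensity fun x : ℝ => ENNReal.ofReal (gaussianPDFReal 0 1 x) := by
    rw [gaussianReal_of_var_ne_zero _ one_ne_zero]; rfl
  simp_rw [h1]
  rw [pi_withDensity_ofReal _ (fun _ x => gaussianPDFReal_nonneg 0 1 x)
    (fun _ => integrable_gaussianPDFReal 0 1)]
  ext s hs
  rw [Measure.map_apply (by fun_prop) hs, withDensity_apply _ hs, withDensity_apply _
    ((WithLp.measurable_toLp 2 _) hs), ← volume_pi,
    ← (PiLp.volume_preserving_toLp (Fin m)).setLIntegral_comp_preimage hs (by fun_prop)]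
  refine lintegral_congr fun x => ?_
  simp only [gaussianPDFReal, stdGaussianPDF, Finset.prod_mul_distrib, ← Real.exp_sum,
    EuclideanSpace.real_norm_sq_eq]
  simp [Finset.sum_div, neg_div]

/-- The Cameron-Martin formula for the standard Gaussian law. -/
theorem map_add_const_stdGaussian {m : ℕ} (h : Vec m) :
    (stdGaussian (Vec m)).map (· + h) = (stdGaussian (Vec m)).withDensity
      fun z => ENNReal.ofReal (Real.exp (inner ℝ h z - ‖h‖ ^ 2 / 2)) := by
  rw [stdGaussian_eq_withDensity, ← withDensity_mul _ (by fun_prop) (by fun_prop)]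
  ext s hs
  rw [Measure.map_apply (by fun_prop) hs, withDensity_apply _ hs,
    withDensity_apply _ (measurable_add_const h hs),
    ← (measurePreserving_add_right volume h).setLIntegral_comp_preimage hs (by fun_prop)]
  refine lintegral_congr fun x => ?_
  simp only [Pi.mul_apply]
  rw [← ENNReal.ofReal_mul (stdGaussianPDF_pos _ _).le]
  simp only [stdGaussianPDF]
  rw [mul_assoc, ← Real.exp_add]
  congr 3
  rw [norm_add_sq_real, inner_add_right, real_inner_self_eq_norm_sq, real_inner_comm]
  ring

/-! ### Divergence of Gaussian mixtures -/

open InformationTheory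

theorem klDiv_withDensity_ofReal {X : Type*} [MeasurableSpace X] {ν : Measure X}
    [IsFiniteMeasure ν] {r : X → ℝ} (hr : Measurable r) (hr0 : ∀ x, 0 ≤ r x)
    [IsFiniteMeasure (ν.withDensity fun x => ENNReal.ofReal (r x))] :
    klDiv (ν.withDensity fun x => ENNReal.ofReal (r x)) ν =
      ∫⁻ x, ENNReal.ofReal (klFun (r x)) ∂ν := by
  rw [klDiv_eq_lintegral_klFun_of_ac (withDensity_absolutelyContinuous _ _)]
  refine lintegral_congr_ae ?_
  filter_upwards [Measure.rnDeriv_withDensity ν hr.ennreal_ofReal] with x hx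
  rw [hx, ENNReal.toReal_ofReal (hr0 x)]

theorem klDiv_map_add_const_stdGaussian {m : ℕ} (h : Vec m) :
    klDiv ((stdGaussian (Vec m)).map (· + h)) (stdGaussian (Vec m)) =
      ENNReal.ofReal (‖h‖ ^ 2 / 2) := by
  have : IsProbabilityMeasure ((stdGaussian (Vec m)).map (· + h)) :=
    Measure.isProbabilityMeasure_map (by fun_prop)
  have hlin : Integrable (fun z => inner ℝ h z) (stdGaussian (Vec m)) :=
    (IsGaussian.integrable_id (μ := stdGaussian (Vec m))).const_inner h
  have hmean : ∫ z, inner ℝ h z ∂(stdGaussian (Vec m)) = 0 :=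
    (integral_inner (IsGaussian.integrable_id (μ := stdGaussian (Vec m))) h).trans (by simp)
  have hac : (stdGaussian (Vec m)).map (· + h) ≪ stdGaussian (Vec m) := by
    rw [map_add_const_stdGaussian]
    exact withDensity_absolutelyContinuous _ _
  have hllr : llr ((stdGaussian (Vec m)).map (· + h)) (stdGaussian (Vec m))
      =ᵐ[(stdGaussian (Vec m)).map (· + h)] fun z => inner ℝ h z - ‖h‖ ^ 2 / 2 := by
    refine hac.ae_le ?_
    rw [map_add_const_stdGaussian]
    filter_upwards [Measure.rnDeriv_withDensity (stdGaussian (Vec m))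
      (f := fun z => ENNReal.ofReal (Real.exp (inner ℝ h z - ‖h‖ ^ 2 / 2))) (by fun_prop)]
      with z hz
    rw [llr, hz, ENNReal.toReal_ofReal (Real.exp_pos _).le, Real.log_exp]
  have hint : Integrable (fun z => inner ℝ h z - ‖h‖ ^ 2 / 2)
      ((stdGaussian (Vec m)).map (· + h)) := by
    rw [integrable_map_measure (by fun_prop) (by fun_prop)]
    have : ((fun z => inner ℝ h z - ‖h‖ ^ 2 / 2) ∘ (· + h)) =
        fun z => inner ℝ h z + (inner ℝ h h - ‖h‖ ^ 2 / 2) := by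
      ext z; simp only [Function.comp, inner_add_right]; ring
    rw [this]
    exact hlin.add (integrable_const _)
  rw [klDiv_of_ac_of_integrable hac ((integrable_congr hllr).2 hint), integral_congr_ae hllr,
    integral_map (by fun_prop) (by fun_prop)]
  have : ∀ z, inner ℝ h (z + h) - ‖h‖ ^ 2 / 2 = inner ℝ h z + ‖h‖ ^ 2 / 2 := fun z => by
    rw [inner_add_right, real_inner_self_eq_norm_sq]; ring
  simp_rw [this]
  rw [integral_add hlin (integrable_const _), hmean]
  simp

/-- Translating a standard Gaussian vector by an independent random vector `h b` costs the mean
of `‖h b‖² / 2`, when `b` itself is kept. -/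
theorem klDiv_prod_stdGaussian_shift {X : Type*} [MeasurableSpace X] (β : Measure X)
    [IsProbabilityMeasure β] {m : ℕ} {h : X → Vec m} (hh : Measurable h) :
    klDiv ((β.prod (stdGaussian (Vec m))).map fun p => (p.1, p.2 + h p.1))
      (β.prod (stdGaussian (Vec m))) = ∫⁻ b, ENNReal.ofReal (‖h b‖ ^ 2 / 2) ∂β := by
  have hmeas : Measurable fun p : X × Vec m => (p.1, p.2 + h p.1) := by fun_prop
  have hr : Measurable fun p : X × Vec m =>
      Real.exp (inner ℝ (h p.1) p.2 - ‖h p.1‖ ^ 2 / 2) := by fun_prop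
  have hmap : (β.prod (stdGaussian (Vec m))).map (fun p => (p.1, p.2 + h p.1)) =
      (β.prod (stdGaussian (Vec m))).withDensity
        fun p => ENNReal.ofReal (Real.exp (inner ℝ (h p.1) p.2 - ‖h p.1‖ ^ 2 / 2)) := by
    ext s hs
    rw [Measure.map_apply hmeas hs, Measure.prod_apply (hmeas hs), withDensity_apply _ hs,
      ← lintegral_indicator hs,
      lintegral_prod _ (hr.ennreal_ofReal.indicator hs).aemeasurable]
    refine lintegral_congr fun b => ?_
    have hsb : MeasurableSet (Prod.mk b ⁻¹' s) := measurable_prodMk_left hs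
    have e1 : Prod.mk b ⁻¹' ((fun p : X × Vec m => (p.1, p.2 + h p.1)) ⁻¹' s) =
        (· + h b) ⁻¹' (Prod.mk b ⁻¹' s) := rfl
    rw [e1, ← Measure.map_apply (by fun_prop) hsb, map_add_const_stdGaussian,
      withDensity_apply _ hsb, ← lintegral_indicator hsb]
    rfl
  have : IsProbabilityMeasure ((β.prod (stdGaussian (Vec m))).map
      fun p => (p.1, p.2 + h p.1)) := Measure.isProbabilityMeasure_map hmeas.aemeasurable
  rw [hmap] at this ⊢
  rw [klDiv_withDensity_ofReal hr fun _ => (Real.exp_pos _).le,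
    lintegral_prod _ (by fun_prop)]
  refine lintegral_congr fun b => ?_
  have : IsProbabilityMeasure ((stdGaussian (Vec m)).map (· + h b)) :=
    Measure.isProbabilityMeasure_map (by fun_prop)
  rw [← klDiv_map_add_const_stdGaussian, map_add_const_stdGaussian] at *
  rw [klDiv_withDensity_ofReal (by fun_prop) fun _ => (Real.exp_pos _).le]

/-- Two convolutions with the same nondegenerate Gaussian law are close in divergence as soon as
the mixing laws are close in quadratic mean: the divergence is at most that of the two shifted
Gaussians, averaged over an independent pair of shifts. -/
theorem klDiv_conv_map_stdGaussian_le {m : ℕ} (Λ : Vec m ≃L[ℝ] Vec m) (μ ν : Measure (Vec m))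
    [IsProbabilityMeasure μ] [IsProbabilityMeasure ν] :
    klDiv (μ ∗ (stdGaussian (Vec m)).map Λ) (ν ∗ (stdGaussian (Vec m)).map Λ) ≤
      ∫⁻ p, ENNReal.ofReal (‖Λ.symm (p.1 - p.2)‖ ^ 2 / 2) ∂(μ.prod ν) := by
  have hh : Measurable fun p : Vec m × Vec m => Λ.symm (p.1 - p.2) := by fun_prop
  rw [← klDiv_prod_stdGaussian_shift (μ.prod ν) hh]
  have hf : Measurable fun q : (Vec m × Vec m) × Vec m => q.1.2 + Λ q.2 := by fun_prop
  refine le_of_eq_of_le ?_ (klDiv_map_le _ _ hf)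
  have : IsProbabilityMeasure ((stdGaussian (Vec m)).map Λ) :=
    Measure.isProbabilityMeasure_map (by fun_prop)
  have e (i : Vec m × Vec m → Vec m) (hi : Measurable i) (ρ : Measure (Vec m))
      (h : (μ.prod ν).map i = ρ) : ((μ.prod ν).prod (stdGaussian (Vec m))).map
      (fun q => i q.1 + Λ q.2) = ρ ∗ (stdGaussian (Vec m)).map Λ := by
    have : SFinite ρ := h ▸ inferInstance
    rw [Measure.conv, ← h, Measure.map_prod_map _ _ hi (by fun_prop),
      Measure.map_map (by fun_prop) (by fun_prop)]
    rfl
  congr 1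
  · rw [Measure.map_map hf (by fun_prop), ← e Prod.fst measurable_fst μ (by simp)]
    congr 1
    ext1 q
    simp
    abel
  · exact (e Prod.snd measurable_snd ν (by simp)).symm

theorem klDiv_conv_right_le {M : Type*} [AddMonoid M] [MeasurableSpace M] [MeasurableAdd₂ M]
    (μ ν ρ : Measure M) [IsFiniteMeasure μ] [IsFiniteMeasure ν] [IsProbabilityMeasure ρ] :
    klDiv (μ ∗ ρ) (ν ∗ ρ) ≤ klDiv μ ν := by
  rw [Measure.conv, Measure.conv]
  refine (klDiv_map_le _ _ (by fun_prop)).trans ?_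
  rw [← Measure.compProd_const, ← Measure.compProd_const, klDiv_compProd_left]

theorem klDiv_prod_right {X Y : Type*} [MeasurableSpace X] [MeasurableSpace Y]
    (μ ν : Measure X) (ρ : Measure Y) [IsFiniteMeasure μ] [IsFiniteMeasure ν]
    [IsProbabilityMeasure ρ] : klDiv (μ.prod ρ) (ν.prod ρ) = klDiv μ ν := by
  rw [← Measure.compProd_const, ← Measure.compProd_const, klDiv_compProd_left]

/-! ### Invariant laws of stable linear recursions -/

theorem map_dirac_zero {E : Type*} [NormedAddCommGroup E] [NormedSpace ℝ E] [MeasurableSpace E]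
    [BorelSpace E] (L : E →L[ℝ] E) : (Measure.dirac (0 : E)).map L = Measure.dirac 0 := by
  rw [Measure.map_dirac' (by fun_prop), map_zero]

section AffineChain

variable {E : Type*} [NormedAddCommGroup E] [InnerProductSpace ℝ E] [FiniteDimensional ℝ E]
  [MeasurableSpace E] [BorelSpace E]

/-- One step of the linear recursion `e ↦ T e + ξ`, with `ξ` of law `N` independent of `e`, acting
on the law of `e`. -/
noncomputable def affineStep (T : E →L[ℝ] E) (N μ : Measure E) : Measure E := μ.map T ∗ N

variable {T : E →L[ℝ] E} {N : Measure E}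

instance (μ : Measure E) [IsProbabilityMeasure μ] (L : E →L[ℝ] E) :
    IsProbabilityMeasure (μ.map L) := Measure.isProbabilityMeasure_map (by fun_prop)

instance isProbabilityMeasure_affineStep [IsProbabilityMeasure N] (μ : Measure E)
    [IsProbabilityMeasure μ] : IsProbabilityMeasure (affineStep T N μ) := by
  unfold affineStep; infer_instance

instance isProbabilityMeasure_iterate_affineStep [IsProbabilityMeasure N] (μ : Measure E)
    [IsProbabilityMeasure μ] (n : ℕ) : IsProbabilityMeasure ((affineStep T N)^[n] μ) := by
  induction n generalizing μ with
  | zero => simpa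
  | succ n ih => rw [Function.iterate_succ_apply]; infer_instance

/-- Unrolling the recursion. Since the noise is i.i.d., the weight `T ^ k` may be given to the
noise `ξ_k` of step `k` instead of to the one `k` steps before the last, which makes the sum a
partial sum of a fixed series. -/
theorem iterate_affineStep_eq_conv {Ω : Type*} [MeasurableSpace Ω] {P : Measure Ω}
    [IsProbabilityMeasure P] {ξ : ℕ → Ω → E} (hξ : ∀ k, Measurable (ξ k))
    (hlaw : ∀ k, HasLaw (ξ k) N P) (hind : iIndepFun ξ P) (n : ℕ) (μ : Measure E)
    [IsProbabilityMeasure μ] :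
    (affineStep T N)^[n] μ =
      μ.map (T ^ n) ∗ P.map (∑ k ∈ Finset.range n, fun ω => (T ^ k) (ξ k ω)) := by
  have : IsProbabilityMeasure N := (hlaw 0).map_eq ▸ Measure.isProbabilityMeasure_map
    (hξ 0).aemeasurable
  have hm (k) : Measurable fun ω => (T ^ k) (ξ k ω) := by fun_prop
  have hs (n) : Measurable (∑ k ∈ Finset.range n, fun ω => (T ^ k) (ξ k ω)) := by
    convert Finset.measurable_sum (Finset.range n) fun k _ => hm k
    simp
  have hp (n) : IsProbabilityMeasure (P.map (∑ k ∈ Finset.range n, fun ω => (T ^ k) (ξ k ω))) :=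
    Measure.isProbabilityMeasure_map (hs n).aemeasurable
  induction n generalizing μ with
  | zero =>
    simp only [Function.iterate_zero, id_eq, pow_zero, Finset.range_zero, Finset.sum_empty]
    have h1 : P.map (0 : Ω → E) = Measure.dirac 0 := by
      change P.map (fun _ => 0) = _
      simp
    rw [h1, Measure.conv_dirac_zero]
    exact (Measure.map_id).symm
  | succ n ih =>
    rw [Function.iterate_succ_apply, ih, affineStep, Measure.map_conv_continuousLinearMap,
      Finset.sum_range_succ, IndepFun.map_add_eq_map_conv_map
        (hs n) (hm n), Measure.map_map (by fun_prop)
        (by fun_prop), pow_succ]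
    · rw [Measure.conv_assoc, Measure.conv_comm (N.map _)]
      congr 2
      rw [← (hlaw n).map_eq, Measure.map_map (by fun_prop) (hξ n)]
      rfl
    · exact (hind.comp (fun k => T ^ k) fun k => by fun_prop).indepFun_sum_range_succ hm n

/-- The initial law enters the iterates only through its image under `T ^ n`. -/
theorem iterate_affineStep_eq_map_conv [IsProbabilityMeasure N] (n : ℕ) (μ : Measure E)
    [IsProbabilityMeasure μ] : (affineStep T N)^[n] μ =
      μ.map (T ^ n) ∗ (affineStep T N)^[n] (Measure.dirac 0) := by
  obtain ⟨Ω, _, P, ξ, hξ, hlaw, hind, _⟩ := exists_iid ℕ N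
  rw [iterate_affineStep_eq_conv hξ hlaw hind, iterate_affineStep_eq_conv hξ hlaw hind n (.dirac 0),
    map_dirac_zero, Measure.dirac_zero_conv]

/-- The partial sums `∑ T ^ k ξ_k` converge in `L²`, hence in law. -/
theorem exists_tendsto_charFun_iterate [IsProbabilityMeasure N] (hN : MemLp id 2 N)
    (hT : Summable fun k => ‖T ^ k‖) :
    ∃ μ : Measure E, IsProbabilityMeasure μ ∧ MemLp id 2 μ ∧
      ∀ s, Tendsto (fun n => charFun ((affineStep T N)^[n] (Measure.dirac 0)) s) atTop
        (𝓝 (charFun μ s)) := by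
  obtain ⟨Ω, _, P, ξ, hξ, hlaw, hind, _⟩ := exists_iid ℕ N
  have hmem (k) : MemLp (ξ k) 2 P := by
    rw [← (hlaw k).map_eq] at hN
    exact (memLp_map_measure_iff (by fun_prop) (hξ k).aemeasurable).1 hN
  have hnorm (k) : ‖(hmem k).toLp‖ = ‖(hmem 0).toLp‖ := by
    have h (k) : eLpNorm (ξ k) 2 P = eLpNorm id 2 N := by
      rw [← (hlaw k).map_eq, eLpNorm_map_measure (by fun_prop) (by fun_prop)]; rfl
    rw [Lp.norm_toLp, Lp.norm_toLp, h, h]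
  let F : ℕ → Lp E 2 P := fun k => (T ^ k).compLp (hmem k).toLp
  have hF : Summable F := by
    refine Summable.of_norm_bounded (g := fun k => ‖T ^ k‖ * ‖(hmem 0).toLp‖)
      (hT.mul_right _) fun k => ?_
    rw [← hnorm k]
    exact ContinuousLinearMap.norm_compLp_le _ _
  have hS (n) : (∑ k ∈ Finset.range n, F k : Lp E 2 P) =ᵐ[P]
      ∑ k ∈ Finset.range n, fun ω => (T ^ k) (ξ k ω) := by
    induction n with
    | zero => simpa using Lp.coeFn_zero E 2 P
    | succ n ih =>
      rw [Finset.sum_range_succ, Finset.sum_range_succ]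
      filter_upwards [Lp.coeFn_add (∑ k ∈ Finset.range n, F k) (F n), ih,
        ContinuousLinearMap.coeFn_compLp (T ^ n) (hmem n).toLp, (hmem n).coeFn_toLp]
        with ω h1 h2 h3 h4
      rw [h1, Pi.add_apply, Pi.add_apply, h2]
      congr 1
      exact h3.trans (by rw [h4])
  have hlim := tendstoInMeasure_of_tendsto_Lp hF.hasSum.tendsto_sum_nat
  have hmeas : AEMeasurable (∑' k, F k : Lp E 2 P) P :=
    (Lp.aestronglyMeasurable _).aemeasurable
  have hdist := hlim.tendstoInDistribution fun n => (Lp.aestronglyMeasurable _).aemeasurable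
  refine ⟨P.map (∑' k, F k : Lp E 2 P), Measure.isProbabilityMeasure_map hmeas,
    (memLp_map_measure_iff (by fun_prop) hmeas).2 (Lp.memLp _), fun s => ?_⟩
  refine (ProbabilityMeasure.tendsto_iff_tendsto_charFun.1 hdist.tendsto s).congr fun n => ?_
  change charFun (P.map (∑ k ∈ Finset.range n, F k : Lp E 2 P)) s = _
  rw [iterate_affineStep_eq_conv hξ hlaw hind n, map_dirac_zero,
    Measure.dirac_zero_conv, ← Measure.map_congr (hS n)]

theorem charFun_map_continuousLinearMap (μ : Measure E) (L : E →L[ℝ] E) (s : E) :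
    charFun (μ.map L) s = charFun μ (L.adjoint s) := by
  rw [charFun_apply, charFun_apply, integral_map (by fun_prop) (by fun_prop)]
  simp_rw [ContinuousLinearMap.adjoint_inner_right]

theorem charFun_affineStep [IsProbabilityMeasure N] (μ : Measure E) [IsProbabilityMeasure μ]
    (s : E) : charFun (affineStep T N μ) s = charFun μ (T.adjoint s) * charFun N s := by
  rw [affineStep, charFun_conv, charFun_map_continuousLinearMap]

/-- A stable linear recursion driven by square integrable noise has exactly one invariant law, and
this law has a finite second moment. -/
theorem exists_unique_invariant_affineStep [IsProbabilityMeasure N] (hN : MemLp id 2 N)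
    (hT : Summable fun k => ‖T ^ k‖) :
    ∃ μ : Measure E, IsProbabilityMeasure μ ∧ MemLp id 2 μ ∧ affineStep T N μ = μ ∧
      ∀ ν : Measure E, IsProbabilityMeasure ν → affineStep T N ν = ν → ν = μ := by
  obtain ⟨μ, hμ, hmem, hlim⟩ := exists_tendsto_charFun_iterate hN hT
  refine ⟨μ, hμ, hmem, Measure.ext_of_charFun (funext fun s => ?_), fun ν _ hν =>
    Measure.ext_of_charFun (funext fun s => ?_)⟩
  · refine tendsto_nhds_unique ?_ (hlim s |>.comp (tendsto_add_atTop_nat 1))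
    rw [charFun_affineStep]
    refine ((hlim (T.adjoint s)).mul_const (charFun N s)).congr fun n => ?_
    rw [Function.comp, Function.iterate_succ_apply', charFun_affineStep]
  · refine tendsto_nhds_unique (l := atTop) (f := fun _ : ℕ => charFun ν s) tendsto_const_nhds ?_
    have h0 : Tendsto (fun n => (T ^ n).adjoint s) atTop (𝓝 0) := by
      rw [tendsto_zero_iff_norm_tendsto_zero]
      refine squeeze_zero (fun _ => norm_nonneg _) (fun n => ContinuousLinearMap.le_opNorm _ _) ?_
      simpa using hT.tendsto_atTop_zero.mul_const ‖s‖
    have hc : Continuous (charFun ν) := by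
      have : charFun ν = fun t => ∫ x, Complex.exp (inner ℝ x t * Complex.I) ∂ν := rfl
      rw [this]
      refine continuous_of_dominated (bound := fun _ => 1) (fun t => by fun_prop) (fun t => ?_)
        (integrable_const _) (ae_of_all _ fun x => by fun_prop)
      exact ae_of_all _ fun x => (Complex.norm_exp_ofReal_mul_I _).le
    have h1 := ((hc.tendsto 0).comp h0).mul (hlim s)
    rw [charFun_zero, probReal_univ, Complex.ofReal_one, one_mul] at h1
    refine h1.congr fun n => ?_
    have e : (affineStep T N)^[n] ν = ν := Function.iterate_fixed hν n
    conv_rhs => rw [← e, iterate_affineStep_eq_map_conv, charFun_conv,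
      charFun_map_continuousLinearMap]
    rfl

end AffineChain

/-! ### Stability of the error recursion -/

/-- A discrete Lyapunov inequality for the adjoint makes the powers of an operator summable. -/
theorem summable_norm_pow_of_lyapunov {E : Type*} [NormedAddCommGroup E] [InnerProductSpace ℝ E]
    [CompleteSpace E] (T V : E →L[ℝ] E) {c : ℝ} (hc : 0 < c)
    (hV : ∀ x, 0 ≤ inner ℝ x (V x))
    (h : ∀ x, inner ℝ (T.adjoint x) (V (T.adjoint x)) ≤ inner ℝ x (V x) - c * ‖x‖ ^ 2) :
    Summable fun k => ‖T ^ k‖ := by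
  set b := ‖V‖ + c with hb
  have hb0 : 0 < b := by positivity
  set ρ := ‖V‖ / b with hρ
  have hρ0 : 0 ≤ ρ := by positivity
  have hρ1 : ρ < 1 := by rw [hρ, div_lt_one hb0]; linarith
  have hub (x : E) : inner ℝ x (V x) ≤ ‖V‖ * ‖x‖ ^ 2 := by
    calc inner ℝ x (V x) ≤ ‖x‖ * ‖V x‖ := real_inner_le_norm _ _
      _ ≤ ‖x‖ * (‖V‖ * ‖x‖) := by gcongr; exact V.le_opNorm x
      _ = _ := by ring
  have hstep (x : E) : inner ℝ (T.adjoint x) (V (T.adjoint x)) ≤ ρ * inner ℝ x (V x) := by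
    have e : ρ = 1 - c / b := by rw [hρ]; field_simp; linarith
    have h1 : c / b * inner ℝ x (V x) ≤ c * ‖x‖ ^ 2 := by
      calc c / b * inner ℝ x (V x) ≤ c / b * (b * ‖x‖ ^ 2) := by
            gcongr
            refine (hub x).trans ?_
            gcongr
            linarith
        _ = c * ‖x‖ ^ 2 := by field_simp
    rw [e]
    linarith [h x]
  have hpow (n : ℕ) (x : E) : inner ℝ ((T.adjoint ^ n) x) (V ((T.adjoint ^ n) x)) ≤
      ρ ^ n * inner ℝ x (V x) := by
    induction n with
    | zero => simp
    | succ n ih =>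
      rw [pow_succ' T.adjoint, pow_succ' ρ, mul_assoc]
      exact (hstep ((T.adjoint ^ n) x)).trans (by gcongr)
  refine Summable.of_nonneg_of_le (f := fun n => √(b / c) * √ρ ^ n) (fun _ => norm_nonneg _)
    (fun n => ?_) ((summable_geometric_of_lt_one (Real.sqrt_nonneg _)
      ((Real.sqrt_lt' one_pos).2 (by simpa))).mul_left _)
  have hadj : ‖T ^ n‖ = ‖T.adjoint ^ n‖ := by
    rw [← ContinuousLinearMap.star_eq_adjoint, ← star_pow, ContinuousLinearMap.star_eq_adjoint,
      LinearIsometryEquiv.norm_map]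
  rw [hadj]
  refine ContinuousLinearMap.opNorm_le_bound _ (by positivity) fun x => ?_
  refine abs_le_of_sq_le_sq' ?_ (by positivity) |>.2
  have h1 := hpow n x
  have h2 := h ((T.adjoint ^ n) x)
  have h3 := hV (T.adjoint ((T.adjoint ^ n) x))
  have h4 : ρ ^ n * inner ℝ x (V x) ≤ ρ ^ n * (b * ‖x‖ ^ 2) := by
    gcongr
    refine (hub x).trans ?_
    gcongr
    linarith
  rw [mul_pow, mul_pow, ← pow_mul, mul_comm n 2, pow_mul, Real.sq_sqrt (by positivity),
    Real.sq_sqrt hρ0, div_mul_eq_mul_div, div_mul_eq_mul_div, le_div_iff₀ hc]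
  nlinarith

theorem mv_eq_toEuclideanCLM {m : ℕ} (A : Matrix (Fin m) (Fin m) ℝ) (x : Vec m) :
    mv A x = Matrix.toEuclideanCLM (𝕜 := ℝ) A x := rfl

open scoped MatrixOrder in
/-- A nondegenerate Gaussian law is the image of the standard one under `Λ = √W`. -/
theorem exists_multivariateGaussian_eq_map {m : ℕ} {W : Matrix (Fin m) (Fin m) ℝ}
    (hW : W.PosDef) : ∃ Λ : Vec m ≃L[ℝ] Vec m,
      multivariateGaussian 0 W = (stdGaussian (Vec m)).map Λ ∧
      ∀ x : Vec m, inner ℝ x (Matrix.toEuclideanCLM (𝕜 := ℝ) W x) = ‖Λ x‖ ^ 2 := by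
  have hsq : CFC.sqrt W * CFC.sqrt W = W := CFC.sqrt_mul_sqrt_self _ hW.posSemidef.nonneg
  have hu : IsUnit (CFC.sqrt W) := by
    have h1 : IsUnit (CFC.sqrt W * CFC.sqrt W) := by
      rw [hsq]
      exact hW.isUnit
    exact isUnit_of_mul_isUnit_left h1
  obtain ⟨u, hu'⟩ := hu.map (Matrix.toEuclideanCLM (n := Fin m) (𝕜 := ℝ))
  refine ⟨ContinuousLinearEquiv.ofUnit u, ?_, fun x => ?_⟩
  · rw [multivariateGaussian, ← hu']
    simp only [zero_add]
    rfl
  · change _ = ‖(u : Vec m →L[ℝ] Vec m) x‖ ^ 2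
    have hself : IsSelfAdjoint (Matrix.toEuclideanCLM (𝕜 := ℝ) (CFC.sqrt W)) :=
      (CFC.sqrt_nonneg W).isSelfAdjoint.map _
    rw [hu', ← real_inner_self_eq_norm_sq, ← ContinuousLinearMap.adjoint_inner_right,
      hself.adjoint_eq]
    conv_lhs => rw [← hsq, map_mul]
    rfl

namespace Design

variable {m n : ℕ} (S : Design m n)

theorem posDef_Pplus (hW : S.W.PosDef) (hPhat : S.Phat.PosDef) : S.Pplus.PosDef := by
  rw [Pplus]
  refine Matrix.PosDef.posSemidef_add ?_ hW
  simpa using hPhat.posSemidef.mul_mul_conjTranspose_same S.A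

theorem R_eq (hΔ : 0 < S.Δ) (hW : S.W.PosDef) (hPhat : S.Phat.PosDef)
    (hC : S.Phat⁻¹ - S.Pplus⁻¹ = (12 / S.Δ ^ 2) • (S.Cᵀ * S.C)) :
    S.R = S.A * S.Phat * S.Pplus⁻¹ := by
  have hP := S.posDef_Pplus hW hPhat
  have hPu : IsUnit S.Pplus.det := (Matrix.isUnit_iff_isUnit_det _).1 hP.isUnit
  have hQu : IsUnit S.Phat.det := (Matrix.isUnit_iff_isUnit_det _).1 hPhat.isUnit
  set r := S.Δ ^ 2 / 12 with hr
  have hr0 : 0 < r := by positivity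
  have hri : 12 / S.Δ ^ 2 = r⁻¹ := by rw [hr, inv_div]
  rw [hri] at hC
  have hCC : S.Cᵀ * S.C = r • (S.Phat⁻¹ - S.Pplus⁻¹) := by
    rw [hC, smul_smul, mul_inv_cancel₀ hr0.ne', one_smul]
  set G := S.C * S.Pplus * S.Cᵀ + r • (1 : Matrix (Fin m) (Fin m) ℝ) with hG
  have hGpos : G.PosDef := by
    refine Matrix.PosDef.posSemidef_add ?_ (Matrix.PosDef.one.smul hr0)
    simpa using hP.posSemidef.mul_mul_conjTranspose_same S.C
  have hGu : IsUnit G.det := (Matrix.isUnit_iff_isUnit_det _).1 hGpos.isUnit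
  have hJ : S.J = r⁻¹ • (S.Phat * S.Cᵀ) := by
    have h1 : S.Pplus * S.Cᵀ = r⁻¹ • (S.Phat * S.Cᵀ) * G := by
      have h2 : S.Phat * S.Cᵀ * G = r • (S.Pplus * S.Cᵀ) := by
        calc S.Phat * S.Cᵀ * G = S.Phat * (S.Cᵀ * S.C) * S.Pplus * S.Cᵀ + r • (S.Phat * S.Cᵀ) := by
              rw [hG, mul_add, mul_smul_comm, mul_one]
              simp only [mul_assoc]
          _ = r • (S.Pplus * S.Cᵀ) := by
              rw [hCC, mul_smul_comm, mul_sub, Matrix.mul_nonsing_inv _ hQu, smul_mul_assoc,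
                smul_mul_assoc, sub_mul, one_mul, mul_assoc S.Phat, Matrix.nonsing_inv_mul _ hPu,
                mul_one, sub_mul, smul_sub, sub_add_cancel]
      rw [smul_mul_assoc, h2, smul_smul, inv_mul_cancel₀ hr0.ne', one_smul]
    rw [J, ← hr, ← hG, h1, Matrix.mul_nonsing_inv_cancel_right _ _ hGu]
  rw [R, L, hJ, mul_assoc, smul_mul_assoc, mul_assoc S.Phat, hCC, mul_smul_comm, mul_smul_comm,
    mul_smul_comm, smul_smul, inv_mul_cancel₀ hr0.ne', one_smul, mul_sub, Matrix.mul_nonsing_inv _ hQu, mul_sub, mul_one,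
    sub_sub_cancel, mul_assoc]

/-- The error recursion is stable: the prior error covariance `Pplus` solves the Lyapunov
inequality `R Pplus Rᵀ + W ≤ Pplus`. -/
theorem summable_norm_R_pow (hΔ : 0 < S.Δ) (hW : S.W.PosDef) (hPhat : S.Phat.PosDef)
    (hC : S.Phat⁻¹ - S.Pplus⁻¹ = (12 / S.Δ ^ 2) • (S.Cᵀ * S.C)) :
    Summable fun k => ‖Matrix.toEuclideanCLM (𝕜 := ℝ) S.R ^ k‖ := by
  have hP := S.posDef_Pplus hW hPhat
  have hPu : IsUnit S.Pplus.det := (Matrix.isUnit_iff_isUnit_det _).1 hP.isUnit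
  have hQu : IsUnit S.Phat.det := (Matrix.isUnit_iff_isUnit_det _).1 hPhat.isUnit
  have hQt : S.Phatᵀ = S.Phat := by simpa using hPhat.isHermitian.eq
  have hPt : S.Pplusᵀ = S.Pplus := by simpa using hP.isHermitian.eq
  have hLyap : S.Pplus = S.R * S.Pplus * S.Rᵀ + S.W +
      (12 / S.Δ ^ 2) • ((S.C * S.Phat * S.Aᵀ)ᵀ * (S.C * S.Phat * S.Aᵀ)) := by
    have e1 : S.R * S.Pplus * S.Rᵀ = S.A * (S.Phat * S.Pplus⁻¹ * S.Phat) * S.Aᵀ := by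
      rw [S.R_eq hΔ hW hPhat hC, Matrix.nonsing_inv_mul_cancel_right _ _ hPu]
      simp only [Matrix.transpose_mul, Matrix.transpose_nonsing_inv, hPt, hQt, mul_assoc]
    have e2 : (12 / S.Δ ^ 2) • ((S.C * S.Phat * S.Aᵀ)ᵀ * (S.C * S.Phat * S.Aᵀ)) =
        S.A * (S.Phat * (S.Phat⁻¹ - S.Pplus⁻¹) * S.Phat) * S.Aᵀ := by
      rw [hC]
      simp only [Matrix.transpose_mul, Matrix.transpose_transpose, hQt, mul_assoc,
        mul_smul_comm, smul_mul_assoc]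
    rw [e1, e2, mul_sub, Matrix.mul_nonsing_inv _ hQu, sub_mul, one_mul, mul_sub, sub_mul]
    rw [add_right_comm, add_sub_cancel]
    rfl
  obtain ⟨Λ, -, hΛ⟩ := exists_multivariateGaussian_eq_map hW
  set c := (‖(Λ.symm : Vec m →L[ℝ] Vec m)‖ ^ 2 + 1)⁻¹ with hc
  have hc0 : 0 < c := by positivity
  refine summable_norm_pow_of_lyapunov _ (Matrix.toEuclideanCLM (𝕜 := ℝ) S.Pplus) hc0
    (fun x => ?_) fun x => ?_
  · rw [Matrix.inner_toEuclideanCLM]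
    simpa using hP.posSemidef.dotProduct_mulVec_nonneg x.ofLp
  · have hlow : c * ‖x‖ ^ 2 ≤ ‖Λ x‖ ^ 2 := by
      have h1 : ‖x‖ ≤ ‖(Λ.symm : Vec m →L[ℝ] Vec m)‖ * ‖Λ x‖ := by
        simpa using (Λ.symm : Vec m →L[ℝ] Vec m).le_opNorm (Λ x)
      rw [hc, inv_mul_le_iff₀ (by positivity)]
      calc ‖x‖ ^ 2 ≤ (‖(Λ.symm : Vec m →L[ℝ] Vec m)‖ * ‖Λ x‖) ^ 2 := by gcongr
        _ ≤ _ := by rw [mul_pow]; gcongr; linarith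
    have hadj : (Matrix.toEuclideanCLM (𝕜 := ℝ) S.R).adjoint =
        Matrix.toEuclideanCLM (𝕜 := ℝ) S.Rᵀ := by
      rw [← ContinuousLinearMap.star_eq_adjoint, ← map_star]
      simp [Matrix.star_eq_conjTranspose]
    have hq : 0 ≤ inner ℝ x (Matrix.toEuclideanCLM (𝕜 := ℝ)
        ((S.C * S.Phat * S.Aᵀ)ᵀ * (S.C * S.Phat * S.Aᵀ)) x) := by
      rw [Matrix.inner_toEuclideanCLM]
      simpa using (Matrix.posSemidef_conjTranspose_mul_self
        (S.C * S.Phat * S.Aᵀ)).dotProduct_mulVec_nonneg x.ofLp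
    have e := congrArg (fun M => inner ℝ x (Matrix.toEuclideanCLM (𝕜 := ℝ) M x)) hLyap
    simp only [map_add, add_apply, inner_add_right, hΛ] at e
    rw [map_smul, smul_apply, inner_smul_right] at e
    have e3 : inner ℝ x (Matrix.toEuclideanCLM (𝕜 := ℝ) (S.R * S.Pplus * S.Rᵀ) x) =
        inner ℝ ((Matrix.toEuclideanCLM (𝕜 := ℝ) S.R).adjoint x)
          (Matrix.toEuclideanCLM (𝕜 := ℝ) S.Pplus
            ((Matrix.toEuclideanCLM (𝕜 := ℝ) S.R).adjoint x)) := by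
      rw [ContinuousLinearMap.adjoint_inner_left, hadj, map_mul, map_mul]
      rfl
    rw [← e3]
    have : 0 ≤ 12 / S.Δ ^ 2 := by positivity
    nlinarith [mul_nonneg this hq]

end Design

/-! ### Uniform dither -/

/-- The uniform law on `[-Δ/2, Δ/2]`, the law of one coordinate of the dither. -/
noncomputable abbrev unifLaw (Δ : ℝ) : Measure ℝ :=
  (volume : Measure ℝ)[|Set.Icc (-(Δ / 2)) (Δ / 2)]

theorem isProbabilityMeasure_unifLaw {Δ : ℝ} (hΔ : 0 < Δ) : IsProbabilityMeasure (unifLaw Δ) := by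
  refine cond_isProbabilityMeasure_of_finite ?_ ?_
  · rw [Real.volume_Icc]
    simp [hΔ]
  · rw [Real.volume_Icc]
    exact ENNReal.ofReal_ne_top

theorem isProbabilityMeasure_ditherLaw {Δ : ℝ} (hΔ : 0 < Δ) (m : ℕ) :
    IsProbabilityMeasure (ditherLaw m Δ) := by
  have := isProbabilityMeasure_unifLaw hΔ
  exact Measure.isProbabilityMeasure_map (by fun_prop)

theorem unifLaw_eq_smul {Δ : ℝ} (hΔ : 0 < Δ) :
    unifLaw Δ = ENNReal.ofReal Δ⁻¹ • volume.restrict (Set.Icc (-(Δ / 2)) (Δ / 2)) := by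
  rw [unifLaw, ProbabilityTheory.cond, Real.volume_Icc, ENNReal.ofReal_inv_of_pos hΔ]
  congr 3
  ring

theorem ditherLaw_eq_smul {Δ : ℝ} (hΔ : 0 < Δ) (m : ℕ) :
    ditherLaw m Δ = ENNReal.ofReal (Δ⁻¹ ^ m) • volume.restrict (cube m Δ) := by
  have h1 : unifLaw Δ = (volume.restrict (Set.Icc (-(Δ / 2)) (Δ / 2))).withDensity
      fun _ => ENNReal.ofReal Δ⁻¹ := by
    rw [withDensity_const, unifLaw_eq_smul hΔ]
  have hc : cube m Δ = WithLp.ofLp ⁻¹'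
      (Set.univ.pi fun _ : Fin m => Set.Icc (-(Δ / 2)) (Δ / 2)) := by
    ext x; simp [cube, abs_le, ← forall_and, Pi.le_def]
  have hm : MeasurableSet (Set.univ.pi fun _ : Fin m => Set.Icc (-(Δ / 2)) (Δ / 2)) :=
    MeasurableSet.univ_pi fun _ => measurableSet_Icc
  rw [ditherLaw, ← unifLaw, h1, pi_withDensity_ofReal _ (fun _ _ => by positivity)
    fun _ => integrable_const _, ← Measure.restrict_pi_pi, Finset.prod_const, Finset.card_univ,
    Fintype.card_fin, withDensity_const, Measure.map_smul, ← volume_pi, hc,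
    ← (PiLp.volume_preserving_toLp (Fin m)).map_eq, Measure.restrict_map (by fun_prop)
      (hm.preimage (by fun_prop))]
  rfl

theorem measurableSet_cube (m : ℕ) (Δ : ℝ) : MeasurableSet (cube m Δ) := by
  have : cube m Δ = ⋂ i, {x : Vec m | |x i| ≤ Δ / 2} := by ext; simp [cube]
  rw [this]
  exact MeasurableSet.iInter fun i => measurableSet_le (by fun_prop) measurable_const

theorem ae_mem_cube {Δ : ℝ} (hΔ : 0 < Δ) (m : ℕ) : ∀ᵐ d ∂ditherLaw m Δ, d ∈ cube m Δ := by
  rw [ditherLaw_eq_smul hΔ]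
  exact Measure.ae_smul_measure (ae_restrict_mem (measurableSet_cube m Δ)) _

theorem norm_le_of_mem_cube {m : ℕ} {Δ : ℝ} (hΔ : 0 < Δ) {x : Vec m} (hx : x ∈ cube m Δ) :
    ‖x‖ ≤ √m * (Δ / 2) := by
  rw [EuclideanSpace.norm_eq]
  refine Real.sqrt_le_iff.2 ⟨by positivity, ?_⟩
  rw [mul_pow, Real.sq_sqrt (by positivity)]
  calc ∑ i, ‖x i‖ ^ 2 ≤ ∑ _i : Fin m, (Δ / 2) ^ 2 := by
        gcongr with i
        exact hx i
    _ = _ := by simp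

theorem memLp_id_ditherLaw {Δ : ℝ} (hΔ : 0 < Δ) (m : ℕ) : MemLp id 2 (ditherLaw m Δ) := by
  have := isProbabilityMeasure_ditherLaw hΔ m
  exact MemLp.of_bound (by fun_prop) (√m * (Δ / 2))
    ((ae_mem_cube hΔ m).mono fun _ hx => norm_le_of_mem_cube hΔ hx)

/-- The quantization error of `z + d`, as a function of `d`, runs through `[-Δ/2, Δ/2]` at unit
speed, whatever the offset `z`. -/
theorem integral_quantization_error {Δ : ℝ} (hΔ : 0 < Δ) (z : ℝ) (g : ℝ → ℝ) :
    ∫ d in (-(Δ / 2))..(Δ / 2), g (⌊(z + d) / Δ + 1 / 2⌋ * Δ - d - z) =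
      ∫ v in (-(Δ / 2))..(Δ / 2), g v := by
  set f : ℝ → ℝ := fun s => g (⌊s / Δ + 1 / 2⌋ * Δ - s) with hf
  have hper : Function.Periodic f Δ := fun s => by
    simp only [hf]
    congr 1
    have e : (s + Δ) / Δ + 1 / 2 = s / Δ + 1 / 2 + (1 : ℤ) := by
      push_cast; field_simp; ring
    rw [e, Int.floor_add_intCast]
    push_cast
    ring
  have h1 : ∀ d, g (⌊(z + d) / Δ + 1 / 2⌋ * Δ - d - z) = f (z + d) := fun d => by
    simp only [hf]; congr 1; ring
  simp_rw [h1]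
  rw [intervalIntegral.integral_comp_add_left]
  have h2 : z + Δ / 2 = (z + -(Δ / 2)) + Δ := by ring
  have h3 : Δ / 2 = -(Δ / 2) + Δ := by ring
  rw [h2, hper.intervalIntegral_add_eq (z + -(Δ / 2)) (-(Δ / 2)), ← h3]
  calc ∫ x in (-(Δ / 2))..(Δ / 2), f x = ∫ x in (-(Δ / 2))..(Δ / 2), g (-x) := by
        refine intervalIntegral.integral_congr_ae ?_
        filter_upwards [Measure.ae_ne volume (Δ / 2)] with x hx hmem
        rw [Set.uIoc_of_le (by linarith)] at hmem
        have hlt : x < Δ / 2 := lt_of_le_of_ne hmem.2 hx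
        have : ⌊x / Δ + 1 / 2⌋ = 0 := by
          rw [Int.floor_eq_zero_iff]
          have h5 : -(1 / 2) < x / Δ := by rw [lt_div_iff₀ hΔ]; linarith [hmem.1]
          have h6 : x / Δ < 1 / 2 := by rw [div_lt_iff₀ hΔ]; linarith
          constructor <;> linarith
        simp only [hf, this]
        congr 1
        simp
    _ = _ := by rw [intervalIntegral.integral_comp_neg, neg_neg]

theorem unifLaw_real_apply {Δ : ℝ} (hΔ : 0 < Δ) {s : Set ℝ} (hs : MeasurableSet s) :
    (unifLaw Δ).real s = Δ⁻¹ * ∫ x in (-(Δ / 2))..(Δ / 2), s.indicator 1 x := by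
  rw [intervalIntegral.integral_of_le (by linarith), ← integral_Icc_eq_integral_Ioc,
    integral_indicator_one hs, unifLaw_eq_smul hΔ, measureReal_ennreal_smul_apply,
    ENNReal.toReal_ofReal (by positivity)]

theorem map_quantization_error_unifLaw {Δ : ℝ} (hΔ : 0 < Δ) (z : ℝ) :
    (unifLaw Δ).map (fun d => ⌊(z + d) / Δ + 1 / 2⌋ * Δ - d - z) = unifLaw Δ := by
  have := isProbabilityMeasure_unifLaw hΔ
  have hm : Measurable fun d : ℝ => (⌊(z + d) / Δ + 1 / 2⌋ : ℝ) * Δ - d - z := by fun_prop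
  have := Measure.isProbabilityMeasure_map (μ := unifLaw Δ) hm.aemeasurable
  ext s hs
  rw [← ENNReal.toReal_eq_toReal_iff' (measure_ne_top _ _) (measure_ne_top _ _)]
  change ((unifLaw Δ).map _).real s = (unifLaw Δ).real s
  rw [map_measureReal_apply hm hs, unifLaw_real_apply hΔ (hm hs), unifLaw_real_apply hΔ hs,
    ← integral_quantization_error hΔ z (s.indicator 1)]
  rfl

/-- Subtractive dithering: the quantization error `Q(z + d) - d - z` has the law of the dither,
whatever the input `z`. -/
theorem map_quantization_error_ditherLaw {m : ℕ} {Δ : ℝ} (hΔ : 0 < Δ) (z : Vec m) :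
    (ditherLaw m Δ).map (fun d => quantize Δ (z + d) - d - z) = ditherLaw m Δ := by
  have := isProbabilityMeasure_unifLaw hΔ
  have hpi : (Measure.pi fun _ : Fin m => unifLaw Δ).map
      (fun x i => (⌊(z i + x i) / Δ + 1 / 2⌋ : ℝ) * Δ - x i - z i) =
      Measure.pi fun _ : Fin m => unifLaw Δ := by
    rw [Measure.pi_map_pi (f := fun i d => (⌊(z i + d) / Δ + 1 / 2⌋ : ℝ) * Δ - d - z i)
      fun i => by fun_prop]
    simp_rw [map_quantization_error_unifLaw hΔ]
  rw [ditherLaw, Measure.map_map (by fun_prop) (by fun_prop)]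
  conv_rhs => rw [← hpi, Measure.map_map (by fun_prop) (by fun_prop)]
  rfl

/-- A dither vector of the cube has dither mass around it, even when it lies on the boundary: at
least half of each interval `(d i - τ, d i + τ)` stays in `[-Δ/2, Δ/2]`. -/
theorem ditherLaw_near_ge {m : ℕ} {Δ τ : ℝ} (hΔ : 0 < Δ) (hτ : τ ≤ Δ / 2)
    {d : Vec m} (hd : d ∈ cube m Δ) :
    ENNReal.ofReal (τ / Δ) ^ m ≤ ditherLaw m Δ {d' | ∀ i, |d' i - d i| < τ} := by
  have := isProbabilityMeasure_unifLaw hΔ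
  have e : WithLp.toLp 2 ⁻¹' {d' : Vec m | ∀ i, |d' i - d i| < τ} =
      Set.univ.pi fun i => Set.Ioo (d i - τ) (d i + τ) := by
    ext x
    simp only [Set.mem_preimage, Set.mem_ofPred_eq, Set.mem_pi, Set.mem_univ, true_imp_iff,
      Set.mem_Ioo, abs_lt]
    exact forall_congr' fun i => ⟨fun h => ⟨by linarith [h.1], by linarith [h.2]⟩,
      fun h => ⟨by linarith [h.1], by linarith [h.2]⟩⟩
  have hset : MeasurableSet {d' : Vec m | ∀ i, |d' i - d i| < τ} := by
    rw [Set.ofPred_forall]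
    exact MeasurableSet.iInter fun i => measurableSet_lt (by fun_prop) measurable_const
  rw [ditherLaw, Measure.map_apply (by fun_prop) hset, e, Measure.pi_pi]
  calc ENNReal.ofReal (τ / Δ) ^ m = ∏ _i : Fin m, ENNReal.ofReal (τ / Δ) := by simp
    _ ≤ _ := Finset.prod_le_prod' fun i _ => ?_
  rw [← unifLaw, unifLaw_eq_smul hΔ, Measure.smul_apply, Measure.restrict_apply measurableSet_Ioo,
    smul_eq_mul, div_eq_inv_mul, ENNReal.ofReal_mul (by positivity)]
  gcongr
  have hdi := abs_le.1 (hd i)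
  rcases le_total (d i) 0 with h0 | h0
  · calc ENNReal.ofReal τ = volume (Set.Ioo (d i) (d i + τ)) := by simp
      _ ≤ volume (Set.Ioo (d i - τ) (d i + τ) ∩ Set.Icc (-(Δ / 2)) (Δ / 2)) :=
        measure_mono fun x hx => ⟨⟨by linarith [hx.1, hx.2], by linarith [hx.1, hx.2]⟩,
          by linarith [hx.1], by linarith [hx.2]⟩
  · calc ENNReal.ofReal τ = volume (Set.Ioo (d i - τ) (d i)) := by simp
      _ ≤ volume (Set.Ioo (d i - τ) (d i + τ) ∩ Set.Icc (-(Δ / 2)) (Δ / 2)) :=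
        measure_mono fun x hx => ⟨⟨by linarith [hx.1, hx.2], by linarith [hx.1, hx.2]⟩,
          by linarith [hx.1], by linarith [hx.2]⟩

/-- The distance of a uniform variable to the ends of its interval is logarithmically
integrable. -/
theorem integrable_log_margin_unifLaw {Δ : ℝ} (hΔ : 0 < Δ) :
    Integrable (fun v => Real.log ((1 / 2 - v / Δ) * (1 / 2 + v / Δ))) (unifLaw Δ) := by
  rw [unifLaw_eq_smul hΔ]
  refine Integrable.smul_measure ?_ ENNReal.ofReal_ne_top
  have h1 : IntervalIntegrable (fun v => Real.log (1 / 2 - v / Δ)) volume (-(Δ / 2)) (Δ / 2) := by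
    have h := (intervalIntegral.intervalIntegrable_log' (a := 1) (b := 0)).comp_sub_left (1 / 2)
    have h' := h.comp_mul_left (c := Δ⁻¹)
    convert h' using 1
    · ext v; rw [div_eq_inv_mul v]
    · field_simp; norm_num
    · field_simp; norm_num
  have h2 : IntervalIntegrable (fun v => Real.log (1 / 2 + v / Δ)) volume (-(Δ / 2)) (Δ / 2) := by
    have h := (intervalIntegral.intervalIntegrable_log' (a := 0) (b := 1)).comp_add_left (1 / 2)
    have h' := h.comp_mul_left (c := Δ⁻¹)
    convert h' using 1
    · ext v; rw [div_eq_inv_mul v]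
    · field_simp; norm_num
    · field_simp; norm_num
  have h3 := h1.add h2
  rw [intervalIntegrable_iff_integrableOn_Ioo_of_le (by linarith)] at h3
  change IntegrableOn _ _ _
  rw [integrableOn_Icc_iff_integrableOn_Ioo]
  refine h3.congr_fun (fun v hv => ?_) measurableSet_Ioo
  have a1 : v / Δ < 1 / 2 := by rw [div_lt_iff₀ hΔ]; linarith [hv.2]
  have a2 : -(1 / 2) < v / Δ := by rw [lt_div_iff₀ hΔ]; linarith [hv.1]
  rw [Real.log_mul (by linarith) (by linarith)]

/-! ### The chain of errors and dithers -/

namespace Design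

variable {m n : ℕ} (S : Design m n)

/-- The matrix `R` as an operator on Euclidean space. -/
noncomputable abbrev Rop : Vec m →L[ℝ] Vec m := Matrix.toEuclideanCLM (𝕜 := ℝ) S.R

/-- The matrix `-L` as an operator on Euclidean space. -/
noncomputable abbrev negLop : Vec m →L[ℝ] Vec m := -Matrix.toEuclideanCLM (𝕜 := ℝ) S.L

/-- The law of `w - L v`, where `v` is a dither vector independent of the process noise `w`: the
effective noise of the error recursion. -/
noncomputable def noiseLaw : Measure (Vec m) :=
  (ditherLaw m S.Δ).map S.negLop ∗ multivariateGaussian 0 S.W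

/-- The error recursion on laws: from the law of `e_t` to the law of `e_{t+1}`. -/
noncomputable abbrev errStep (μ : Measure (Vec m)) : Measure (Vec m) :=
  affineStep S.Rop S.noiseLaw μ

theorem isProbabilityMeasure_noiseLaw (hΔ : 0 < S.Δ) : IsProbabilityMeasure S.noiseLaw := by
  have := isProbabilityMeasure_ditherLaw hΔ m
  unfold noiseLaw
  infer_instance

theorem drift_eq (e d : Vec m) :
    S.drift e d = S.Rop e + S.negLop (quantize S.Δ (mv S.C e + d) - d - mv S.C e) := by
  rw [drift, output, mv_eq_toEuclideanCLM S.R, mv_eq_toEuclideanCLM S.L, sub_eq_add_neg]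
  rfl

/-- Because of the dither, the quantization error is independent of the prediction error and
distributed as the dither. -/
theorem map_prodMk_quantization_error (hΔ : 0 < S.Δ) (μ : Measure (Vec m))
    [IsProbabilityMeasure μ] :
    (μ.prod (ditherLaw m S.Δ)).map
      (fun z => (z.1, quantize S.Δ (mv S.C z.1 + z.2) - z.2 - mv S.C z.1)) =
      μ.prod (ditherLaw m S.Δ) := by
  have := isProbabilityMeasure_ditherLaw hΔ m
  have hq : Measurable fun z : Vec m × Vec m =>
      (z.1, quantize S.Δ (mv S.C z.1 + z.2) - z.2 - mv S.C z.1) := by fun_prop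
  ext s hs
  rw [Measure.map_apply hq hs, Measure.prod_apply (hq hs), Measure.prod_apply hs]
  refine lintegral_congr fun e => ?_
  conv_rhs => rw [← map_quantization_error_ditherLaw hΔ (mv S.C e),
    Measure.map_apply (by fun_prop) (measurable_prodMk_left hs)]
  rfl

/-- The error recursion is linear in law. -/
theorem map_drift_conv_eq_errStep (hΔ : 0 < S.Δ) (μ : Measure (Vec m)) [IsProbabilityMeasure μ] :
    ((μ.prod (ditherLaw m S.Δ)).map fun z => S.drift z.1 z.2) ∗ multivariateGaussian 0 S.W =
      S.errStep μ := by
  have := isProbabilityMeasure_ditherLaw hΔ m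
  rw [errStep, affineStep, noiseLaw, ← Measure.conv_assoc]
  have h2 : (fun z : Vec m × Vec m => S.drift z.1 z.2) =
      fun z => S.Rop z.1 + S.negLop (quantize S.Δ (mv S.C z.1 + z.2) - z.2 - mv S.C z.1) :=
    funext fun z => S.drift_eq z.1 z.2
  rw [h2]
  congr 1
  rw [Measure.conv, Measure.map_prod_map _ _ (by fun_prop) (by fun_prop)]
  conv_rhs => rw [← S.map_prodMk_quantization_error hΔ μ, Measure.map_map (by fun_prop)
    (by fun_prop), Measure.map_map (by fun_prop) (by fun_prop)]
  rfl

theorem map_drift_add_noise_eq_errStep (hΔ : 0 < S.Δ) (μ : Measure (Vec m))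
    [IsProbabilityMeasure μ] :
    ((μ.prod ((ditherLaw m S.Δ).prod (multivariateGaussian 0 S.W))).map
      fun p => S.drift p.1 p.2.1 + p.2.2) = S.errStep μ := by
  have := isProbabilityMeasure_ditherLaw hΔ m
  have hd := S.measurable_drift
  have h0 : Measure.map id (multivariateGaussian (0 : Vec m) S.W) =
      multivariateGaussian 0 S.W := Measure.map_id
  rw [← S.map_drift_conv_eq_errStep hΔ, Measure.conv]
  conv_rhs => rw [← h0, Measure.map_prod_map _ _ hd measurable_id, Measure.map_map (by fun_prop)
    (by fun_prop)]
  rw [← Measure.prodAssoc_prod, Measure.map_map (by fun_prop) (by fun_prop)]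
  rfl

theorem bind_transition (hΔ : 0 < S.Δ) (π : Measure (Vec m × Vec m)) [IsProbabilityMeasure π] :
    π.bind S.transition =
      ((π.map fun z => S.drift z.1 z.2) ∗ multivariateGaussian 0 S.W).prod (ditherLaw m S.Δ) := by
  have := isProbabilityMeasure_ditherLaw hΔ m
  have hd := S.measurable_drift
  have : IsProbabilityMeasure (π.map fun z => S.drift z.1 z.2) :=
    Measure.isProbabilityMeasure_map hd.aemeasurable
  have hf : Measurable fun p : Vec m × Vec m × Vec m => (p.1 + p.2.1, p.2.2) := by fun_prop
  have h0 : Measure.map id (ditherLaw m S.Δ) = ditherLaw m S.Δ := Measure.map_id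
  have hR : ((π.map fun z => S.drift z.1 z.2) ∗ multivariateGaussian 0 S.W).prod
      (ditherLaw m S.Δ) = ((π.map fun z => S.drift z.1 z.2).prod
        ((multivariateGaussian 0 S.W).prod (ditherLaw m S.Δ))).map
          fun p => (p.1 + p.2.1, p.2.2) := by
    rw [← Measure.prodAssoc_prod, Measure.map_map hf (by fun_prop), Measure.conv]
    conv_lhs => rw [← h0, Measure.map_prod_map _ _ (by fun_prop) measurable_id]
    rfl
  rw [hR]
  ext s hs
  rw [Measure.bind_apply hs S.transition.aemeasurable, Measure.map_apply hf hs,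
    Measure.prod_apply (hf hs), lintegral_map (measurable_measure_prodMk_left (hf hs)) hd]
  refine lintegral_congr fun z => ?_
  rw [transition, Kernel.map_apply _ hf, Kernel.prod_apply, Kernel.deterministic_apply,
    Kernel.const_apply, Measure.dirac_prod, Measure.map_map hf (by fun_prop),
    Measure.map_apply (by fun_prop) hs]
  rfl

theorem isInvariantLaw_prod (hΔ : 0 < S.Δ) {μ : Measure (Vec m)} [IsProbabilityMeasure μ]
    (h : S.errStep μ = μ) : S.IsInvariantLaw (μ.prod (ditherLaw m S.Δ)) := by
  have := isProbabilityMeasure_ditherLaw hΔ m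
  refine ⟨inferInstance, ?_⟩
  rw [Kernel.Invariant, S.bind_transition hΔ, S.map_drift_conv_eq_errStep hΔ, h]

theorem IsInvariantLaw.exists_eq_prod (hΔ : 0 < S.Δ) {π : Measure (Vec m × Vec m)}
    (hπ : S.IsInvariantLaw π) : ∃ μ : Measure (Vec m), IsProbabilityMeasure μ ∧
      S.errStep μ = μ ∧ π = μ.prod (ditherLaw m S.Δ) := by
  have := hπ.isProbabilityMeasure
  have hd := S.measurable_drift
  have hinv := hπ.invariant
  rw [Kernel.Invariant, S.bind_transition hΔ] at hinv
  have : IsProbabilityMeasure (π.map fun z => S.drift z.1 z.2) :=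
    Measure.isProbabilityMeasure_map hd.aemeasurable
  refine ⟨_, inferInstance, ?_, hinv.symm⟩
  rw [← S.map_drift_conv_eq_errStep hΔ, hinv]

theorem err_succ (x₀ : Vec m) (w d : ℕ → Vec m) (t : ℕ) :
    S.err x₀ w d (t + 1) = S.drift (S.err x₀ w d t) (d t) + w t := by
  have hmul (A B : Vec m →L[ℝ] Vec m) (x : Vec m) : (A * B) x = A (B x) := rfl
  simp only [err, loop, posterior, drift, R, L, mv_eq_toEuclideanCLM, map_sub, map_mul, map_add,
    sub_apply, hmul]
  abel

section ClosedLoop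

variable {Ω : Type*} {mΩ : MeasurableSpace Ω} {P : Measure Ω}
  {x₀ : Ω → Vec m} {w d : ℕ → Ω → Vec m}

/-- The prediction error `e_t` is independent of the noise `d_t, w_t` of the current step. -/
theorem indepFun_err (hx₀ : Measurable x₀) (hw : ∀ t, Measurable (w t))
    (hd : ∀ t, Measurable (d t))
    (hindep : iIndepFun (Sum.elim (fun _ : Unit => x₀) (Sum.elim w d)) P) (t : ℕ) :
    IndepFun (fun ω => S.err (x₀ ω) (fun s => w s ω) (fun s => d s ω) t)
      (fun ω => (d t ω, w t ω)) P := by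
  set F : Unit ⊕ ℕ ⊕ ℕ → Ω → Vec m := Sum.elim (fun _ : Unit => x₀) (Sum.elim w d) with hF
  let σ : Unit ⊕ ℕ ⊕ ℕ → MeasurableSpace Ω := fun i => MeasurableSpace.comap (F i) inferInstance
  let I : ℕ → Set (Unit ⊕ ℕ ⊕ ℕ) := fun t => {i | i.elim (fun _ => True) (Sum.elim (· < t) (· < t))}
  have hFm : ∀ i, Measurable (F i) := by
    rintro (_ | s | s)
    exacts [hx₀, hw s, hd s]
  have hle : ∀ i, σ i ≤ mΩ := fun i => (hFm i).comap_le
  have hmem (J : Set (Unit ⊕ ℕ ⊕ ℕ)) (i) (hi : i ∈ J) : Measurable[⨆ j ∈ J, σ j] (F i) :=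
    Measurable.mono (comap_measurable (F i)) (le_iSup₂_of_le i hi le_rfl) le_rfl
  have hmono (t) : (⨆ j ∈ I t, σ j) ≤ ⨆ j ∈ I (t + 1), σ j := by
    refine biSup_mono fun i hi => ?_
    rcases i with _ | s | s
    · trivial
    · exact Nat.lt_succ_of_lt (show s < t from hi)
    · exact Nat.lt_succ_of_lt (show s < t from hi)
  have herr (t) : Measurable[⨆ j ∈ I t, σ j]
      (fun ω => S.err (x₀ ω) (fun s => w s ω) (fun s => d s ω) t) := by
    induction t with
    | zero =>
      have : (fun ω => S.err (x₀ ω) (fun s => w s ω) (fun s => d s ω) 0) = x₀ := by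
        ext1 ω; simp [err, loop]
      rw [this]
      exact hmem (I 0) (.inl ()) trivial
    | succ t ih =>
      simp_rw [err_succ]
      have h1 := ih.mono (hmono t) le_rfl
      have h2 := hmem (I (t + 1)) (.inr (.inr t)) (Nat.lt_succ_self t)
      have h3 := hmem (I (t + 1)) (.inr (.inl t)) (Nat.lt_succ_self t)
      exact (S.measurable_drift.comp (h1.prodMk h2)).add h3
  let J : Set (Unit ⊕ ℕ ⊕ ℕ) := {.inr (.inl t), .inr (.inr t)}
  have hdisj : Disjoint (I t) J := by
    rw [Set.disjoint_left]
    rintro i hi (rfl | rfl) <;> exact lt_irrefl t hi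
  have hind := indep_iSup_of_disjoint hle hindep.iIndep hdisj
  refine (IndepFun_iff_Indep _ _ _).2 (indep_of_indep_of_le_left (indep_of_indep_of_le_right hind ?_) ?_)
  · exact ((hmem J (.inr (.inr t)) (by simp [J])).prodMk
      (hmem J (.inr (.inl t)) (by simp [J]))).comap_le
  · exact (herr t).comap_le

theorem measurable_err (hx₀ : Measurable x₀) (hw : ∀ t, Measurable (w t))
    (hd : ∀ t, Measurable (d t)) (t : ℕ) :
    Measurable fun ω => S.err (x₀ ω) (fun s => w s ω) (fun s => d s ω) t := by
  induction t with
  | zero => simpa [err, loop] using hx₀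
  | succ t ih =>
    simp_rw [err_succ]
    exact (S.measurable_drift.comp (ih.prodMk (hd t))).add (hw t)

theorem map_err_eq_iterate [IsProbabilityMeasure P] (hΔ : 0 < S.Δ) (hx₀ : Measurable x₀) (hw : ∀ t, Measurable (w t))
    (hd : ∀ t, Measurable (d t)) (hwl : ∀ t, P.map (w t) = multivariateGaussian 0 S.W)
    (hdl : ∀ t, P.map (d t) = ditherLaw m S.Δ)
    (hindep : iIndepFun (Sum.elim (fun _ : Unit => x₀) (Sum.elim w d)) P) (t : ℕ) :
    P.map (fun ω => S.err (x₀ ω) (fun s => w s ω) (fun s => d s ω) t) =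
        S.errStep^[t] (P.map x₀) ∧
      P.map (fun ω => (S.err (x₀ ω) (fun s => w s ω) (fun s => d s ω) t, d t ω)) =
        (S.errStep^[t] (P.map x₀)).prod (ditherLaw m S.Δ) := by
  have := isProbabilityMeasure_ditherLaw hΔ m
  have hm := S.measurable_err hx₀ hw hd
  have hdw (t) : P.map (fun ω => (d t ω, w t ω)) =
      (ditherLaw m S.Δ).prod (multivariateGaussian 0 S.W) := by
    have h : IndepFun (d t) (w t) P :=
      hindep.indepFun (i := .inr (.inr t)) (j := .inr (.inl t)) (by simp)
    rw [(indepFun_iff_map_prod_eq_prod_map_map (hd t).aemeasurable (hw t).aemeasurable).1 h,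
      hwl, hdl]
  have hjoint (t) : P.map (fun ω => (S.err (x₀ ω) (fun s => w s ω) (fun s => d s ω) t,
      (d t ω, w t ω))) = (P.map (fun ω => S.err (x₀ ω) (fun s => w s ω) (fun s => d s ω) t)).prod
        ((ditherLaw m S.Δ).prod (multivariateGaussian 0 S.W)) := by
    rw [(indepFun_iff_map_prod_eq_prod_map_map (hm t).aemeasurable
      ((hd t).prodMk (hw t)).aemeasurable).1 (S.indepFun_err hx₀ hw hd hindep t), hdw]
  have hpr (t) : IsProbabilityMeasure
      (P.map (fun ω => S.err (x₀ ω) (fun s => w s ω) (fun s => d s ω) t)) :=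
    Measure.isProbabilityMeasure_map (hm t).aemeasurable
  have hlaw : P.map (fun ω => S.err (x₀ ω) (fun s => w s ω) (fun s => d s ω) t) =
      S.errStep^[t] (P.map x₀) := by
    induction t with
    | zero => simp [err, loop]
    | succ t ih =>
      have hdr := S.measurable_drift
      rw [Function.iterate_succ_apply', ← ih, ← S.map_drift_add_noise_eq_errStep hΔ, ← hjoint,
        Measure.map_map (by fun_prop) ((hm t).prodMk ((hd t).prodMk (hw t)))]
      simp_rw [err_succ]
      rfl
  refine ⟨hlaw, ?_⟩
  rw [← hlaw]
  have h0 : Measurable fun p : Vec m × Vec m × Vec m => (p.1, p.2.1) := by fun_prop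
  have h := congrArg (Measure.map fun p : Vec m × Vec m × Vec m => (p.1, p.2.1)) (hjoint t)
  rw [Measure.map_map h0 ((hm t).prodMk ((hd t).prodMk (hw t)))] at h
  refine h.trans ?_
  have e : (fun p : Vec m × Vec m × Vec m => (p.1, p.2.1)) = Prod.map id Prod.fst := rfl
  rw [e, ← Measure.map_prod_map _ _ measurable_id measurable_fst, Measure.map_id]
  simp

/-- The law of `q_t` is the image, under the quantized output, of the product of the law of `e_t`
and the law of the dither. -/
theorem map_quant_eq [IsProbabilityMeasure P] (hΔ : 0 < S.Δ) {X₀ : Matrix (Fin m) (Fin m) ℝ}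
    (hx₀ : HasLaw x₀ (multivariateGaussian 0 X₀) P)
    (hw : ∀ t, HasLaw (w t) (multivariateGaussian 0 S.W) P)
    (hd : ∀ t, HasLaw (d t) (ditherLaw m S.Δ) P)
    (hindep : iIndepFun (Sum.elim (fun _ : Unit => x₀) (Sum.elim w d)) P) (t : ℕ) :
    P.map (fun ω => S.quant (x₀ ω) (fun s => w s ω) (fun s => d s ω) t) =
      S.outputLaw ((S.errStep^[t] (multivariateGaussian 0 X₀)).prod (ditherLaw m S.Δ)) := by
  have ha := hx₀.aemeasurable
  have hb := fun t => (hw t).aemeasurable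
  have hc := fun t => (hd t).aemeasurable
  set x₁ := ha.mk x₀
  set w₁ := fun t => (hb t).mk (w t)
  set d₁ := fun t => (hc t).mk (d t)
  have hx₁ : Measurable x₁ := ha.measurable_mk
  have hw₁ : ∀ t, Measurable (w₁ t) := fun t => (hb t).measurable_mk
  have hd₁ : ∀ t, Measurable (d₁ t) := fun t => (hc t).measurable_mk
  have hind : iIndepFun (Sum.elim (fun _ : Unit => x₁) (Sum.elim w₁ d₁)) P := by
    refine (iIndepFun_congr ?_).1 hindep
    rintro (_ | s | s)
    exacts [ha.ae_eq_mk, (hb s).ae_eq_mk, (hc s).ae_eq_mk]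
  have hae : ∀ᵐ ω ∂P, S.quant (x₀ ω) (fun s => w s ω) (fun s => d s ω) t =
      S.quant (x₁ ω) (fun s => w₁ s ω) (fun s => d₁ s ω) t := by
    filter_upwards [ha.ae_eq_mk, ae_all_iff.2 fun s => (hb s).ae_eq_mk,
      ae_all_iff.2 fun s => (hc s).ae_eq_mk] with ω h1 h2 h3
    rw [h1, funext h2, funext h3]
  have hl := (S.map_err_eq_iterate hΔ hx₁ hw₁ hd₁
    (fun t => by rw [← (hw t).map_eq, Measure.map_congr (hb t).ae_eq_mk])
    (fun t => by rw [← (hd t).map_eq, Measure.map_congr (hc t).ae_eq_mk]) hind t).2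
  rw [Measure.map_congr hae, outputLaw, ← hx₀.map_eq, Measure.map_congr ha.ae_eq_mk, ← hl,
    Measure.map_map S.measurable_output ((S.measurable_err hx₁ hw₁ hd₁ t).prodMk (hd₁ t))]
  rfl

end ClosedLoop

end Design

/-! ### Densities, lower bounds and finite divergence -/

open InformationTheory

theorem exists_map_stdGaussian_eq_withDensity {m : ℕ} (Λ : Vec m ≃L[ℝ] Vec m) :
    ∃ c : ℝ, 0 < c ∧ (stdGaussian (Vec m)).map Λ =
      volume.withDensity fun x => ENNReal.ofReal (c * Real.exp (-(‖Λ.symm x‖ ^ 2 / 2))) := by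
  have hH : Measure.IsAddHaarMeasure ((volume : Measure (Vec m)).map Λ) :=
    Λ.isAddHaarMeasure_map volume
  have hv := Measure.isAddLeftInvariant_eq_smul ((volume : Measure (Vec m)).map Λ) volume
  set k := Measure.addHaarScalarFactor ((volume : Measure (Vec m)).map Λ) volume with hk
  have hk0 : 0 < k := Measure.addHaarScalarFactor_pos_of_isAddHaarMeasure _ _
  refine ⟨k * (√(2 * Real.pi))⁻¹ ^ m, by positivity, ?_⟩
  rw [stdGaussian_eq_withDensity]
  ext s hs
  have hpre : MeasurableSet (Λ ⁻¹' s) := hs.preimage (by fun_prop)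
  rw [Measure.map_apply (by fun_prop) hs, withDensity_apply _ hpre, withDensity_apply _ hs]
  have h1 : ∫⁻ x in Λ ⁻¹' s, ENNReal.ofReal (stdGaussianPDF m x) =
      ∫⁻ x in Λ ⁻¹' s, ENNReal.ofReal (stdGaussianPDF m (Λ.symm (Λ x))) := by simp
  rw [h1, ← setLIntegral_map (f := fun y => ENNReal.ofReal (stdGaussianPDF m (Λ.symm y))) hs
    (by fun_prop) (by fun_prop), hv, Measure.restrict_smul, lintegral_smul_measure,
    ENNReal.smul_def, smul_eq_mul, ← lintegral_const_mul' _ _ ENNReal.coe_ne_top]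
  refine lintegral_congr fun x => ?_
  rw [stdGaussianPDF, mul_assoc, ENNReal.ofReal_mul k.coe_nonneg, ENNReal.ofReal_coe_nnreal]

/-- A law smoothed by a nondegenerate Gaussian has a density that decays at most as fast as some
Gaussian. -/
theorem exists_conv_map_stdGaussian_eq_withDensity {m : ℕ} (Λ : Vec m ≃L[ℝ] Vec m)
    (ρ : Measure (Vec m)) [IsProbabilityMeasure ρ] :
    ∃ (g : Vec m → ℝ) (a b : ℝ), Measurable g ∧ 0 < a ∧ 0 ≤ b ∧
      (∀ x, a * Real.exp (-(b * ‖x‖ ^ 2)) ≤ g x) ∧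
      ρ ∗ (stdGaussian (Vec m)).map Λ = volume.withDensity fun x => ENNReal.ofReal (g x) := by
  obtain ⟨c, hc, hG⟩ := exists_map_stdGaussian_eq_withDensity Λ
  set φ : Vec m → ℝ := fun x => c * Real.exp (-(‖Λ.symm x‖ ^ 2 / 2)) with hφ
  have hφm : Measurable φ := by fun_prop
  have hφ0 : ∀ x, 0 ≤ φ x := fun x => by positivity
  have hφint (x : Vec m) : Integrable (fun y => φ (x - y)) ρ := by
    refine Integrable.of_bound (C := c) (by fun_prop) (ae_of_all _ fun y => ?_)
    rw [Real.norm_of_nonneg (hφ0 _)]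
    refine mul_le_of_le_one_right hc.le (Real.exp_le_one_iff.2 ?_)
    simp only [Left.neg_nonpos_iff]; positivity
  -- a ball that carries part of the mass of `ρ`
  obtain ⟨r, hr⟩ : ∃ r : ℕ, 0 < ρ (Metric.closedBall 0 r) := by
    by_contra! hcon
    have : ρ Set.univ = 0 := by
      rw [← Metric.iUnion_closedBall_nat (0 : Vec m)]
      exact measure_iUnion_null fun n => le_antisymm (hcon n) zero_le
    simp at this
  set L := ‖(Λ.symm : Vec m →L[ℝ] Vec m)‖ with hL
  have hρr : 0 < ρ.real (Metric.closedBall 0 r) :=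
    ENNReal.toReal_pos hr.ne' (measure_ne_top _ _)
  refine ⟨fun x => ∫ y, φ (x - y) ∂ρ, ρ.real (Metric.closedBall 0 r) *
    (c * Real.exp (-(L ^ 2 * r ^ 2))), L ^ 2, ?_, by positivity, by positivity, fun x => ?_, ?_⟩
  · have h : Measurable fun p : Vec m × Vec m => φ (p.1 - p.2) := by fun_prop
    exact h.stronglyMeasurable.integral_prod_right.measurable
  · calc ρ.real (Metric.closedBall 0 r) * (c * Real.exp (-(L ^ 2 * r ^ 2))) *
          Real.exp (-(L ^ 2 * ‖x‖ ^ 2))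
        = ∫ _y in Metric.closedBall (0 : Vec m) r,
            c * Real.exp (-(L ^ 2 * r ^ 2) + -(L ^ 2 * ‖x‖ ^ 2)) ∂ρ := by
          rw [setIntegral_const, smul_eq_mul, Real.exp_add]; ring
      _ ≤ ∫ y in Metric.closedBall (0 : Vec m) r, φ (x - y) ∂ρ := by
          refine setIntegral_mono_on (integrable_const _) (hφint x).integrableOn
            Metric.isClosed_closedBall.measurableSet fun y hy => ?_
          have hy' : ‖y‖ ≤ r := by simpa using hy
          have h1 : ‖Λ.symm (x - y)‖ ≤ L * (‖x‖ + r) :=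
            ((Λ.symm : Vec m →L[ℝ] Vec m).le_opNorm _).trans
              (by gcongr; exact (norm_sub_le _ _).trans (by gcongr))
          have h2 : ‖Λ.symm (x - y)‖ ^ 2 ≤ (L * (‖x‖ + r)) ^ 2 := by gcongr
          simp only [hφ]
          gcongr
          nlinarith [sq_nonneg (L * (‖x‖ - r))]
      _ ≤ ∫ y, φ (x - y) ∂ρ :=
          setIntegral_le_integral (hφint x) (ae_of_all _ fun y => hφ0 _)
  · ext s hs
    have hadd : Measurable fun p : Vec m × Vec m => p.1 + p.2 := by fun_prop
    rw [hG]
    have : SFinite (volume.withDensity fun x : Vec m => ENNReal.ofReal (φ x)) := inferInstance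
    rw [Measure.conv, Measure.map_apply hadd hs, Measure.prod_apply (hadd hs),
      withDensity_apply _ hs]
    have h1 : ∀ y, (volume.withDensity fun x : Vec m => ENNReal.ofReal (φ x))
        (Prod.mk y ⁻¹' ((fun p : Vec m × Vec m => p.1 + p.2) ⁻¹' s)) =
        ∫⁻ x in s, ENNReal.ofReal (φ (x - y)) := fun y => by
      rw [withDensity_apply _ (measurable_prodMk_left (hadd hs)),
        ← (measurePreserving_add_left volume y).setLIntegral_comp_preimage hs (by fun_prop)]
      refine lintegral_congr fun x => ?_
      rw [add_sub_cancel_left]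
    rw [lintegral_congr h1, lintegral_lintegral_swap (by fun_prop)]
    refine lintegral_congr fun x => ?_
    rw [ofReal_integral_eq_lintegral_ofReal (hφint x) (ae_of_all _ fun y => hφ0 _)]

/-- A Gaussian lower bound on a density gives one, in the centre, on the mass of small balls. -/
theorem measure_ball_ge_of_withDensity {m : ℕ} {g : Vec m → ℝ} {a b : ℝ} (ha : 0 < a) (hb : 0 ≤ b)
    (hg : ∀ x, a * Real.exp (-(b * ‖x‖ ^ 2)) ≤ g x) (x : Vec m) {r R : ℝ} (hr : 0 < r)
    (hrR : r ≤ R) :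
    ENNReal.ofReal (a * Real.exp (-(2 * b * R ^ 2)) *
        (volume : Measure (Vec m)).real (Metric.ball 0 1) *
        Real.exp (-(2 * b * ‖x‖ ^ 2)) * r ^ m) ≤
      (volume.withDensity fun x => ENNReal.ofReal (g x)) (Metric.ball x r) := by
  have hvol : volume (Metric.ball x r) = ENNReal.ofReal (r ^ m *
      (volume : Measure (Vec m)).real (Metric.ball 0 1)) := by
    rw [Measure.addHaar_ball_of_pos _ _ hr, ENNReal.ofReal_mul (by positivity), finrank_euclideanSpace_fin,
      measureReal_def, ENNReal.ofReal_toReal measure_ball_lt_top.ne]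
  rw [withDensity_apply _ Metric.isOpen_ball.measurableSet]
  calc _ = ENNReal.ofReal (a * Real.exp (-(2 * b * R ^ 2) + -(2 * b * ‖x‖ ^ 2))) *
        volume (Metric.ball x r) := by
        rw [hvol, ← ENNReal.ofReal_mul (by positivity), Real.exp_add]; congr 1; ring
    _ = ∫⁻ _y in Metric.ball x r,
        ENNReal.ofReal (a * Real.exp (-(2 * b * R ^ 2) + -(2 * b * ‖x‖ ^ 2))) := by simp
    _ ≤ _ := by
        refine setLIntegral_mono' Metric.isOpen_ball.measurableSet fun y hy => ?_
        refine ENNReal.ofReal_le_ofReal (le_trans ?_ (hg y))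
        have h1 : ‖y‖ ≤ ‖x‖ + R := by
          have : ‖y - x‖ < r := by simpa [dist_eq_norm] using hy
          linarith [norm_le_norm_add_norm_sub' y x]
        have h2 : ‖y‖ ^ 2 ≤ (‖x‖ + R) ^ 2 := by gcongr
        have h3 : ‖y‖ ^ 2 ≤ 2 * ‖x‖ ^ 2 + 2 * R ^ 2 := by nlinarith [sq_nonneg (‖x‖ - R)]
        gcongr
        nlinarith

theorem measurable_measure_singleton {X : Type*} [MeasurableSpace X] [MeasurableEq X]
    (ν : Measure X) [SFinite ν] : Measurable fun x => ν {x} := by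
  have h := measurable_measure_prodMk_left (ν := ν) (measurableSet_diagonal (α := X))
  convert h using 3 with x
  ext y
  simp [eq_comm]

/-- The divergence from `ν` is finite as soon as `x ↦ -log ν {x}` is integrable. -/
theorem klDiv_ne_top_of_lintegral_log {X : Type*} [MeasurableSpace X] [MeasurableEq X]
    [MeasurableSingletonClass X] (μ ν : Measure X)
    [IsFiniteMeasure μ] [IsProbabilityMeasure ν] (hμ : μ Set.univ ≤ 1)
    (hpos : ∀ᵐ x ∂μ, ν {x} ≠ 0)
    (hlog : ∫⁻ x, ENNReal.ofReal (-Real.log (ν.real {x})) ∂μ ≠ ∞) : klDiv μ ν ≠ ∞ := by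
  have hac : μ ≪ ν := by
    refine Measure.AbsolutelyContinuous.mk fun s _ hs => ?_
    refine measure_eq_zero_iff_ae_notMem.2 (hpos.mono fun x hx hxs => hx ?_)
    exact measure_mono_null (Set.singleton_subset_iff.2 hxs) hs
  have hm : Measurable fun x => ENNReal.ofReal (-Real.log (ν.real {x})) :=
    ((measurable_measure_singleton ν).ennreal_toReal.log.neg).ennreal_ofReal
  rw [klDiv_eq_lintegral_klFun_of_ac hac]
  have hpos' : ∀ᵐ x ∂ν, μ.rnDeriv ν x ≠ 0 → ν {x} ≠ 0 := by
    rw [← Measure.withDensity_rnDeriv_eq μ ν hac] at hpos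
    exact (ae_withDensity_iff (Measure.measurable_rnDeriv μ ν)).1 hpos
  have hle : ∀ᵐ x ∂ν, ENNReal.ofReal (klFun (μ.rnDeriv ν x).toReal) ≤
      1 + μ.rnDeriv ν x * ENNReal.ofReal (-Real.log (ν.real {x})) := by
    filter_upwards [hpos', Measure.rnDeriv_lt_top μ ν] with x hx hlt
    by_cases h0 : μ.rnDeriv ν x = 0
    · simp [h0, klFun_zero]
    have hp : 0 < ν.real {x} := ENNReal.toReal_pos (hx h0) (measure_ne_top _ _)
    have hf : 0 < (μ.rnDeriv ν x).toReal := ENNReal.toReal_pos h0 hlt.ne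
    have hmul : (μ.rnDeriv ν x).toReal * ν.real {x} ≤ 1 := by
      rw [measureReal_def, ← ENNReal.toReal_mul]
      refine ENNReal.toReal_le_of_le_ofReal zero_le_one ?_
      rw [ENNReal.ofReal_one, ← lintegral_singleton, ← withDensity_apply _
        (measurableSet_singleton x), Measure.withDensity_rnDeriv_eq μ ν hac]
      exact (measure_mono (Set.subset_univ _)).trans hμ
    have hlogle : Real.log (μ.rnDeriv ν x).toReal ≤ -Real.log (ν.real {x}) := by
      have := Real.log_nonpos (by positivity) hmul
      rw [Real.log_mul hf.ne' hp.ne'] at this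
      linarith
    conv_rhs => rw [← ENNReal.ofReal_toReal hlt.ne, ← ENNReal.ofReal_mul hf.le,
      ← ENNReal.ofReal_one]
    have hlog0 : 0 ≤ -Real.log (ν.real {x}) :=
      neg_nonneg.2 (Real.log_nonpos hp.le measureReal_le_one)
    rw [← ENNReal.ofReal_add zero_le_one (by positivity)]
    refine ENNReal.ofReal_le_ofReal ?_
    rw [klFun]
    nlinarith
  refine ((lintegral_mono_ae hle).trans_lt ?_).ne
  rw [lintegral_add_left measurable_const, lintegral_rnDeriv_mul hac hm.aemeasurable]
  simpa using lt_top_iff_ne_top.2 hlog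

/-! ### Divergence of the quantizer output -/

open InformationTheory

theorem quantize_eq_of_abs_sub_lt {m : ℕ} {Δ : ℝ} (hΔ : 0 < Δ) {z z' : Vec m}
    (h : ∀ i, |z' i - z i| < Δ / 2 - |quantize Δ z i - z i|) : quantize Δ z' = quantize Δ z := by
  ext i
  have hq : quantize Δ z i = (⌊z i / Δ + 1 / 2⌋ : ℝ) * Δ := rfl
  have hi := h i
  rw [hq] at hi ⊢
  rw [quantize_apply_eq_iff hΔ]
  have h1 := abs_lt.1 (show |z' i - (⌊z i / Δ + 1 / 2⌋ : ℝ) * Δ| < Δ / 2 by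
    calc |z' i - (⌊z i / Δ + 1 / 2⌋ : ℝ) * Δ|
        = |(z' i - z i) - ((⌊z i / Δ + 1 / 2⌋ : ℝ) * Δ - z i)| := by congr 1; ring
      _ ≤ _ := abs_sub _ _
      _ < Δ / 2 := by linarith)
  constructor <;> linarith [h1.1, h1.2]

namespace Design

variable {m n : ℕ} (S : Design m n)

theorem memLp_id_noiseLaw (hΔ : 0 < S.Δ) : MemLp id 2 S.noiseLaw := by
  have := isProbabilityMeasure_ditherLaw hΔ m
  have h1 : MemLp id 2 ((ditherLaw m S.Δ).map S.negLop) :=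
    (memLp_map_measure_iff (by fun_prop) (by fun_prop)).2
      (S.negLop.comp_memLp' (memLp_id_ditherLaw hΔ m))
  have h2 : MemLp id 2 (multivariateGaussian (0 : Vec m) S.W) := IsGaussian.memLp_two_id
  rw [noiseLaw, Measure.conv]
  refine (memLp_map_measure_iff (by fun_prop) (by fun_prop)).2 ?_
  exact (h1.comp_fst _).add (h2.comp_snd _)

/-- After `t + 1` steps the divergence between two error laws is controlled by the squared norm
of `R ^ (t + 1)`: the common noise of all steps only lowers the divergence, and the Gaussian part
of the last one turns the distance of the initial states into a divergence. -/
theorem klDiv_iterate_errStep_le (hΔ : 0 < S.Δ) {Λ : Vec m ≃L[ℝ] Vec m}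
    (hΛ : multivariateGaussian 0 S.W = (stdGaussian (Vec m)).map Λ) (μ ν : Measure (Vec m))
    [IsProbabilityMeasure μ] [IsProbabilityMeasure ν] (t : ℕ) :
    klDiv (S.errStep^[t + 1] μ) (S.errStep^[t + 1] ν) ≤
      ENNReal.ofReal (‖S.Rop ^ (t + 1)‖ ^ 2) * ∫⁻ p, ENNReal.ofReal
        (‖(Λ.symm : Vec m →L[ℝ] Vec m)‖ ^ 2 * ‖p.1 - p.2‖ ^ 2 / 2) ∂(μ.prod ν) := by
  have := isProbabilityMeasure_ditherLaw hΔ m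
  have := S.isProbabilityMeasure_noiseLaw hΔ
  have e (μ : Measure (Vec m)) [IsProbabilityMeasure μ] : S.errStep^[t + 1] μ =
      (μ.map (S.Rop ^ (t + 1)) ∗ (stdGaussian (Vec m)).map Λ) ∗
        ((S.errStep^[t] (Measure.dirac 0)).map S.Rop ∗ (ditherLaw m S.Δ).map S.negLop) := by
    rw [Function.iterate_succ_apply', iterate_affineStep_eq_map_conv, errStep, affineStep, noiseLaw,
      Measure.map_conv_continuousLinearMap, Measure.map_map (by fun_prop) (by fun_prop), hΛ,
      pow_succ', Measure.conv_assoc, Measure.conv_assoc]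
    congr 1
    rw [← Measure.conv_assoc, Measure.conv_comm, ← hΛ]
    rfl
  rw [e μ, e ν]
  have : IsProbabilityMeasure ((stdGaussian (Vec m)).map Λ) := hΛ ▸ inferInstance
  refine (klDiv_conv_right_le _ _ _).trans ((klDiv_conv_map_stdGaussian_le Λ _ _).trans ?_)
  rw [Measure.map_prod_map _ _ (by fun_prop) (by fun_prop), lintegral_map (by fun_prop)
    (by fun_prop), ← lintegral_const_mul _ (by fun_prop)]
  refine lintegral_mono fun p => ?_
  rw [← ENNReal.ofReal_mul (by positivity)]
  refine ENNReal.ofReal_le_ofReal ?_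
  simp only [Prod.map_fst, Prod.map_snd, ← map_sub]
  have h1 : ‖Λ.symm ((S.Rop ^ (t + 1)) (p.1 - p.2))‖ ≤
      ‖(Λ.symm : Vec m →L[ℝ] Vec m)‖ * (‖S.Rop ^ (t + 1)‖ * ‖p.1 - p.2‖) :=
    ((Λ.symm : Vec m →L[ℝ] Vec m).le_opNorm _).trans
      (by gcongr; exact (S.Rop ^ (t + 1)).le_opNorm _)
  calc _ ≤ (‖(Λ.symm : Vec m →L[ℝ] Vec m)‖ * (‖S.Rop ^ (t + 1)‖ * ‖p.1 - p.2‖)) ^ 2 / 2 := by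
        gcongr
    _ = _ := by ring

theorem klDiv_outputLaw_prod_le (hΔ : 0 < S.Δ) (μ ν : Measure (Vec m)) [IsProbabilityMeasure μ]
    [IsProbabilityMeasure ν] :
    klDiv (S.outputLaw (μ.prod (ditherLaw m S.Δ))) (S.outputLaw (ν.prod (ditherLaw m S.Δ))) ≤
      klDiv μ ν := by
  have := isProbabilityMeasure_ditherLaw hΔ m
  exact (klDiv_map_le _ _ S.measurable_output).trans (klDiv_prod_right _ _ _).le

theorem exists_density_of_errStep_eq (hΔ : 0 < S.Δ) {Λ : Vec m ≃L[ℝ] Vec m}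
    (hΛ : multivariateGaussian 0 S.W = (stdGaussian (Vec m)).map Λ) {μ : Measure (Vec m)}
    [IsProbabilityMeasure μ] (h : S.errStep μ = μ) :
    ∃ (g : Vec m → ℝ) (a b : ℝ), Measurable g ∧ 0 < a ∧ 0 ≤ b ∧
      (∀ x, a * Real.exp (-(b * ‖x‖ ^ 2)) ≤ g x) ∧
      μ = volume.withDensity fun x => ENNReal.ofReal (g x) := by
  have := isProbabilityMeasure_ditherLaw hΔ m
  obtain ⟨g, a, b, hg, ha, hb, hlow, heq⟩ := exists_conv_map_stdGaussian_eq_withDensity Λ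
    (μ.map S.Rop ∗ (ditherLaw m S.Δ).map S.negLop)
  refine ⟨g, a, b, hg, ha, hb, hlow, ?_⟩
  rw [← heq, ← hΛ, Measure.conv_assoc]
  exact h.symm

theorem prod_ditherLaw_eq_withDensity (hΔ : 0 < S.Δ) {g : Vec m → ℝ} (hg : Measurable g)
    [SFinite (volume.withDensity fun x => ENNReal.ofReal (g x))] :
    (volume.withDensity fun x => ENNReal.ofReal (g x)).prod (ditherLaw m S.Δ) =
      (volume.restrict (Set.univ ×ˢ cube m S.Δ)).withDensity
        fun z => ENNReal.ofReal (S.Δ⁻¹ ^ m * g z.1) := by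
  rw [ditherLaw_eq_smul hΔ, ← withDensity_const, prod_withDensity hg.ennreal_ofReal
    measurable_const, Measure.volume_eq_prod, ← Measure.prod_restrict, Measure.restrict_univ]
  congr 1
  ext1 z
  rw [mul_comm, ENNReal.ofReal_mul (by positivity)]

/-- The quantization error of the output `Q(C e + d)`. -/
noncomputable def quantError (z : Vec m × Vec m) : Vec m :=
  quantize S.Δ (mv S.C z.1 + z.2) - z.2 - mv S.C z.1

@[fun_prop]
theorem measurable_quantError : Measurable S.quantError := by
  unfold quantError; fun_prop

theorem map_quantError_apply (hΔ : 0 < S.Δ) (μ : Measure (Vec m)) [IsProbabilityMeasure μ]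
    (i : Fin m) :
    (μ.prod (ditherLaw m S.Δ)).map (fun z => S.quantError z i) = unifLaw S.Δ := by
  have := isProbabilityMeasure_ditherLaw hΔ m
  have := isProbabilityMeasure_unifLaw hΔ
  have h1 := congrArg (Measure.map fun z : Vec m × Vec m => z.2 i)
    (S.map_prodMk_quantization_error hΔ μ)
  have h2 : Measurable fun z : Vec m × Vec m => z.2 i := by fun_prop
  rw [Measure.map_map h2 (by fun_prop)] at h1
  refine h1.trans ?_
  have h3 : (fun z : Vec m × Vec m => z.2 i) = (fun x : Vec m => x i) ∘ Prod.snd := rfl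
  rw [h3, ← Measure.map_map (by fun_prop) measurable_snd, Measure.map_snd_prod, measure_univ,
    one_smul, ditherLaw, Measure.map_map (by fun_prop) (by fun_prop)]
  exact (measurePreserving_eval (fun _ : Fin m => unifLaw S.Δ) i).map_eq

/-- The relative distance, up to a constant factor, from the `i`-th coordinate of the quantizer
input to the boundary of its cell. -/
noncomputable def margin (z : Vec m × Vec m) (i : Fin m) : ℝ :=
  (1 / 2 - S.quantError z i / S.Δ) * (1 / 2 + S.quantError z i / S.Δ)

theorem ae_margin_pos (hΔ : 0 < S.Δ) (μ : Measure (Vec m)) [IsProbabilityMeasure μ] :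
    ∀ᵐ z ∂μ.prod (ditherLaw m S.Δ), ∀ i, 0 < S.margin z i := by
  refine ae_all_iff.2 fun i => ?_
  have h : ∀ᵐ v ∂unifLaw S.Δ, 0 < (1 / 2 - v / S.Δ) * (1 / 2 + v / S.Δ) := by
    rw [unifLaw_eq_smul hΔ]
    refine Measure.ae_smul_measure ?_ _
    rw [← restrict_Ioo_eq_restrict_Icc]
    filter_upwards [ae_restrict_mem measurableSet_Ioo] with v hv
    have a1 : v / S.Δ < 1 / 2 := by rw [div_lt_iff₀ hΔ]; linarith [hv.2]
    have a2 : -(1 / 2) < v / S.Δ := by rw [lt_div_iff₀ hΔ]; linarith [hv.1]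
    exact mul_pos (by linarith) (by linarith)
  rw [← S.map_quantError_apply hΔ μ i] at h
  exact ae_of_ae_map (f := fun z => S.quantError z i) (by fun_prop) h

theorem integrable_log_margin (hΔ : 0 < S.Δ) (μ : Measure (Vec m)) [IsProbabilityMeasure μ]
    (i : Fin m) : Integrable (fun z => Real.log (S.margin z i)) (μ.prod (ditherLaw m S.Δ)) := by
  have h := integrable_log_margin_unifLaw hΔ
  rw [← S.map_quantError_apply hΔ μ i] at h
  exact h.comp_measurable (by fun_prop)

/-- A lower bound for the probability, under a law whose first marginal has a density with Gaussian
lower bound, that the quantizer output is the one at `(e, d)`. -/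
theorem exists_outputLaw_singleton_ge (hΔ : 0 < S.Δ) {g : Vec m → ℝ} {a b : ℝ} (ha : 0 < a)
    (hb : 0 ≤ b) (hg : ∀ x, a * Real.exp (-(b * ‖x‖ ^ 2)) ≤ g x)
    [SFinite (volume.withDensity fun x => ENNReal.ofReal (g x))] :
    ∃ c : ℝ, 0 < c ∧ ∀ e d : Vec m, d ∈ cube m S.Δ → (∀ i, 0 < S.margin (e, d) i) →
      ENNReal.ofReal (c * Real.exp (-(2 * b * ‖e‖ ^ 2)) * (∏ i, S.margin (e, d) i) ^ (2 * m)) ≤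
        S.outputLaw ((volume.withDensity fun x => ENNReal.ofReal (g x)).prod (ditherLaw m S.Δ))
          {S.output e d} := by
  have := isProbabilityMeasure_ditherLaw hΔ m
  set V := (volume : Measure (Vec m)).real (Metric.ball 0 1) with hV
  have hV0 : 0 < V := ENNReal.toReal_pos (Metric.measure_ball_pos _ _ one_pos).ne'
    measure_ball_lt_top.ne
  set Cop : Vec m →L[ℝ] Vec m := Matrix.toEuclideanCLM (𝕜 := ℝ) S.C with hCop
  set κ := ‖Cop‖ + 1 with hκ
  have hκ1 : 1 ≤ κ := by rw [hκ]; linarith [norm_nonneg Cop]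
  have hκ0 : 0 < κ := by linarith
  refine ⟨a * Real.exp (-(2 * b * S.Δ ^ 2)) * V * (S.Δ / (2 * κ)) ^ m * (1 / 2) ^ m,
    by positivity, fun e d hd hpos => ?_⟩
  set σ := ∏ i, S.margin (e, d) i with hσ
  have hσ0 : 0 < σ := Finset.prod_pos fun i _ => hpos i
  have hv (i) : |S.quantError (e, d) i| < S.Δ / 2 := by
    have h := hpos i
    rw [margin] at h
    set u := S.quantError (e, d) i / S.Δ with hu
    have h2 : |u| < 1 / 2 := abs_lt_of_sq_lt_sq (by nlinarith) (by norm_num)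
    rw [hu, abs_div, abs_of_pos hΔ, div_lt_iff₀ hΔ] at h2
    linarith
  -- the product `σ` of the margins, all at most one, bounds each of them from below, and `Δ σ`
  -- bounds from below the distance of each input to the boundary of its cell
  have hm1 (i) : S.margin (e, d) i ≤ 1 := by
    rw [margin]; nlinarith [sq_nonneg (S.quantError (e, d) i / S.Δ)]
  have hσi (i) : σ ≤ S.margin (e, d) i := by
    rw [hσ, ← Finset.mul_prod_erase _ _ (Finset.mem_univ i)]
    exact mul_le_of_le_one_right (hpos i).le
      (Finset.prod_le_one (fun j _ => (hpos j).le) fun j _ => hm1 j)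
  have hσ1 : σ ≤ 1 := Finset.prod_le_one (fun j _ => (hpos j).le) fun j _ => hm1 j
  have hcell (i) : S.Δ * σ ≤ S.Δ / 2 - |S.quantError (e, d) i| := by
    have h2 : S.Δ * S.margin (e, d) i ≤ S.Δ / 2 - |S.quantError (e, d) i| := by
      have h3 := hv i
      have h4 : S.Δ * S.margin (e, d) i = (S.Δ / 2 - |S.quantError (e, d) i|) *
          ((S.Δ / 2 + |S.quantError (e, d) i|) / S.Δ) := by
        rw [margin]
        field_simp
        nlinarith [sq_abs (S.quantError (e, d) i)]
      rw [h4]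
      refine mul_le_of_le_one_right (by linarith) ?_
      rw [div_le_one hΔ]
      linarith
    exact (mul_le_mul_of_nonneg_left (hσi i) hΔ.le).trans h2
  -- moving `e` by less than `r` moves `C e` by at most `Δ σ / 2`, half of that distance
  set r := S.Δ * σ / (2 * κ) with hr
  have hr0 : 0 < r := by positivity
  have hrΔ : r ≤ S.Δ := by
    rw [hr, div_le_iff₀ (by positivity)]
    nlinarith
  -- a product neighbourhood of `(e, d)` that stays in the cell of the quantizer
  have hsub : Metric.ball e r ×ˢ {d' : Vec m | ∀ i, |d' i - d i| < S.Δ * σ / 2} ⊆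
      (fun z : Vec m × Vec m => S.output z.1 z.2) ⁻¹' {S.output e d} := by
    rintro ⟨y, d'⟩ ⟨hy, hd'⟩
    refine quantize_eq_of_abs_sub_lt hΔ fun i => ?_
    have h1 : |(mv S.C y) i - (mv S.C e) i| ≤ S.Δ * σ / 2 := by
      have h2 : ‖Cop (y - e)‖ ≤ κ * r := by
        refine (Cop.le_opNorm _).trans ?_
        have : ‖y - e‖ ≤ r := by
          have : ‖y - e‖ < r := by simpa [dist_eq_norm] using hy
          exact this.le
        gcongr
        linarith
      have h3 : κ * r = S.Δ * σ / 2 := by rw [hr]; field_simp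
      rw [← h3]
      refine le_trans ?_ h2
      have h4 := PiLp.norm_apply_le (Cop (y - e)) i
      rw [map_sub] at h4 ⊢
      exact h4
    have h5 : quantize S.Δ (mv S.C e + d) i - (mv S.C e + d) i = S.quantError (e, d) i := by
      simp only [quantError, PiLp.sub_apply, PiLp.add_apply]; ring
    rw [h5]
    calc |(mv S.C y + d') i - (mv S.C e + d) i|
        = |((mv S.C y) i - (mv S.C e) i) + (d' i - d i)| := by
          simp only [PiLp.add_apply]; congr 1; ring
      _ ≤ |(mv S.C y) i - (mv S.C e) i| + |d' i - d i| := abs_add_le _ _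
      _ < S.Δ * σ / 2 + S.Δ * σ / 2 := add_lt_add_of_le_of_lt h1 (hd' i)
      _ = S.Δ * σ := by ring
      _ ≤ _ := hcell i
  have hball := measure_ball_ge_of_withDensity ha hb hg e hr0 hrΔ
  have hdith := ditherLaw_near_ge (m := m) (τ := S.Δ * σ / 2) hΔ (by nlinarith) hd
  rw [outputLaw, Measure.map_apply S.measurable_output (measurableSet_singleton _)]
  refine le_trans ?_ (measure_mono hsub)
  rw [Measure.prod_prod]
  refine le_trans (le_of_eq ?_) (mul_le_mul' hball hdith)
  rw [← ENNReal.ofReal_pow (by positivity), ← ENNReal.ofReal_mul (by positivity)]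
  congr 1
  have h6 : S.Δ * σ / 2 / S.Δ = 1 / 2 * σ := by field_simp
  have h7 : r = S.Δ / (2 * κ) * σ := by rw [hr]; ring
  rw [h6, h7, mul_pow, mul_pow]
  ring

/-- The divergence of the quantizer output from its stationary law is finite for every square
integrable prediction error, whether or not the latter has a density: on average, `(e, d)` is at a
logarithmically integrable distance from the boundary of the quantizer cell. -/
theorem klDiv_outputLaw_ne_top (hΔ : 0 < S.Δ) {g : Vec m → ℝ} {a b : ℝ} (ha : 0 < a)
    (hb : 0 ≤ b) (hg : ∀ x, a * Real.exp (-(b * ‖x‖ ^ 2)) ≤ g x)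
    [IsProbabilityMeasure (volume.withDensity fun x => ENNReal.ofReal (g x))]
    (μ : Measure (Vec m)) [IsProbabilityMeasure μ] (hμ : MemLp id 2 μ) :
    klDiv (S.outputLaw (μ.prod (ditherLaw m S.Δ)))
      (S.outputLaw ((volume.withDensity fun x => ENNReal.ofReal (g x)).prod
        (ditherLaw m S.Δ))) ≠ ∞ := by
  have := isProbabilityMeasure_ditherLaw hΔ m
  have hout := S.measurable_output
  obtain ⟨c, hc, hlow⟩ := S.exists_outputLaw_singleton_ge hΔ ha hb hg
  set ν := S.outputLaw ((volume.withDensity fun x => ENNReal.ofReal (g x)).prod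
    (ditherLaw m S.Δ)) with hν
  have hνp : IsProbabilityMeasure ν := Measure.isProbabilityMeasure_map hout.aemeasurable
  have hμp : IsProbabilityMeasure (S.outputLaw (μ.prod (ditherLaw m S.Δ))) :=
    Measure.isProbabilityMeasure_map hout.aemeasurable
  have hcube : ∀ᵐ z ∂μ.prod (ditherLaw m S.Δ), z.2 ∈ cube m S.Δ :=
    Measure.quasiMeasurePreserving_snd.ae (ae_mem_cube hΔ m)
  have hprod {z : Vec m × Vec m} (hz : ∀ i, 0 < S.margin z i) : 0 < ∏ i, S.margin z i :=
    Finset.prod_pos fun i _ => hz i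
  have hsing := measurable_measure_singleton ν
  have hlogm : Measurable fun x => ENNReal.ofReal (-Real.log (ν.real {x})) :=
    (hsing.ennreal_toReal.log.neg).ennreal_ofReal
  refine klDiv_ne_top_of_lintegral_log _ _ (by simp) ?_ ?_
  · rw [outputLaw, ae_map_iff hout.aemeasurable (p := fun x => ν {x} ≠ 0)
      (hsing (measurableSet_singleton 0).compl)]
    filter_upwards [hcube, S.ae_margin_pos hΔ μ] with z hz1 hz2
    refine ((ENNReal.ofReal_pos.2 ?_).trans_le (hlow z.1 z.2 hz1 hz2)).ne'
    have := hprod hz2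
    positivity
  · rw [outputLaw, lintegral_map hlogm hout]
    have hint : Integrable (fun z : Vec m × Vec m => -Real.log c + 2 * b * ‖z.1‖ ^ 2 -
        2 * m * ∑ i, Real.log (S.margin z i)) (μ.prod (ditherLaw m S.Δ)) := by
      refine ((integrable_const _).add ?_).sub
        ((integrable_finsetSum _ fun i _ => S.integrable_log_margin hΔ μ i).const_mul _)
      exact ((hμ.integrable_norm_pow two_ne_zero).comp_fst _).const_mul _
    refine (lt_of_le_of_lt (lintegral_mono_ae ?_) hint.lintegral_lt_top).ne
    filter_upwards [hcube, S.ae_margin_pos hΔ μ] with z hz1 hz2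
    refine ENNReal.ofReal_le_ofReal ?_
    have h0 := hprod hz2
    have h1 := ENNReal.toReal_mono (measure_ne_top _ _) (hlow z.1 z.2 hz1 hz2)
    rw [ENNReal.toReal_ofReal (by positivity)] at h1
    have h2 := Real.log_le_log (by positivity) h1
    rw [Real.log_mul (by positivity) (by positivity), Real.log_mul (by positivity) (by positivity),
      Real.log_exp, Real.log_pow, Real.log_prod fun i _ => (hz2 i).ne'] at h2
    push_cast at h2
    rw [measureReal_def]
    linarith

end Design

end DitheredLQG

theorem lemma2 {m n : ℕ} (S : DitheredLQG.Design m n)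
    (hΔ : 0 < S.Δ) (hW : S.W.PosDef) (hPhat : S.Phat.PosDef)
    (hC : S.Phat⁻¹ - S.Pplus⁻¹ = (12 / S.Δ ^ 2) • (S.Cᵀ * S.C))
    (X₀ : Matrix (Fin m) (Fin m) ℝ) (hX₀ : X₀.PosSemidef)
    {Ω : Type*} [MeasurableSpace Ω] (P : Measure Ω) [IsProbabilityMeasure P]
    (x₀ : Ω → Vec m) (w d : ℕ → Ω → Vec m)
    (hx₀ : HasLaw x₀ (multivariateGaussian 0 X₀) P)
    (hw : ∀ t, HasLaw (w t) (multivariateGaussian 0 S.W) P)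
    (hd : ∀ t, HasLaw (d t) (DitheredLQG.ditherLaw m S.Δ) P)
    (hindep : iIndepFun (Sum.elim (fun _ : Unit => x₀) (Sum.elim w d)) P) :
    -- there is an invariant law with a positive density on `ℝ^m × cube`
    (∃ g : Vec m × Vec m → ℝ, Measurable g ∧
      (∀ z ∈ Set.univ ×ˢ DitheredLQG.cube m S.Δ, 0 < g z) ∧
      S.IsInvariantLaw
        ((volume.restrict (Set.univ ×ˢ DitheredLQG.cube m S.Δ)).withDensity
          fun z => ENNReal.ofReal (g z))) ∧
    -- for every invariant law, the divergence of `q_t` from `q` is finite and tends to zero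
    ∀ π : Measure (Vec m × Vec m), S.IsInvariantLaw π →
      (∀ t, InformationTheory.klDiv
        (P.map fun ω => S.quant (x₀ ω) (fun s => w s ω) (fun s => d s ω) t)
        (S.outputLaw π) < ∞) ∧
      Tendsto (fun t => InformationTheory.klDiv
        (P.map fun ω => S.quant (x₀ ω) (fun s => w s ω) (fun s => d s ω) t)
        (S.outputLaw π)) atTop (𝓝 0) := by
  have := S.isProbabilityMeasure_noiseLaw hΔ
  obtain ⟨Λ, hΛ, -⟩ := DitheredLQG.exists_multivariateGaussian_eq_map hW
  have hT := S.summable_norm_R_pow hΔ hW hPhat hC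
  obtain ⟨μ, hμp, hμ2, hμ, huniq⟩ :=
    DitheredLQG.exists_unique_invariant_affineStep (S.memLp_id_noiseLaw hΔ) hT
  obtain ⟨g, a, b, hgm, ha, hb, hlow, hdens⟩ := S.exists_density_of_errStep_eq hΔ hΛ hμ
  refine ⟨⟨fun z => S.Δ⁻¹ ^ m * g z.1, by fun_prop, fun z _ => ?_, ?_⟩, fun π hπ => ?_⟩
  · have h1 := hlow z.1
    have h2 : 0 < g z.1 := lt_of_lt_of_le (by positivity) h1
    positivity
  · have : IsProbabilityMeasure (volume.withDensity fun x => ENNReal.ofReal (g x)) := hdens ▸ hμp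
    rw [← S.prod_ditherLaw_eq_withDensity hΔ hgm, ← hdens]
    exact S.isInvariantLaw_prod hΔ hμ
  obtain ⟨ν, hν, hνinv, rfl⟩ := hπ.exists_eq_prod S hΔ
  obtain rfl := huniq ν hν hνinv
  simp_rw [S.map_quant_eq hΔ hx₀ hw hd hindep]
  set K := ∫⁻ p, ENNReal.ofReal (‖(Λ.symm : Vec m →L[ℝ] Vec m)‖ ^ 2 * ‖p.1 - p.2‖ ^ 2 / 2)
    ∂((multivariateGaussian 0 X₀).prod ν) with hK
  have hX2 : MemLp id 2 (multivariateGaussian (0 : Vec m) X₀) := IsGaussian.memLp_two_id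
  have hKtop : K < ∞ := by
    have h : MemLp (fun p : Vec m × Vec m => p.1 - p.2) 2 ((multivariateGaussian 0 X₀).prod ν) :=
      (hX2.comp_fst ν).sub (hμ2.comp_snd _)
    exact (((h.integrable_norm_pow two_ne_zero).const_mul _).div_const 2).lintegral_lt_top
  have hbound (t : ℕ) : InformationTheory.klDiv
      (S.outputLaw ((S.errStep^[t + 1] (multivariateGaussian 0 X₀)).prod (DitheredLQG.ditherLaw m S.Δ)))
      (S.outputLaw (ν.prod (DitheredLQG.ditherLaw m S.Δ))) ≤
        ENNReal.ofReal (‖S.Rop ^ (t + 1)‖ ^ 2) * K := by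
    refine (S.klDiv_outputLaw_prod_le hΔ _ _).trans ?_
    conv_lhs => rw [← Function.iterate_fixed hμ (t + 1)]
    exact S.klDiv_iterate_errStep_le hΔ hΛ _ _ t
  refine ⟨fun t => ?_, ?_⟩
  · rcases t with _ | t
    · have : IsProbabilityMeasure (volume.withDensity fun x => ENNReal.ofReal (g x)) :=
        hdens ▸ hμp
      rw [hdens]
      exact lt_top_iff_ne_top.2 (S.klDiv_outputLaw_ne_top hΔ ha hb hlow _ hX2)
    · exact (hbound t).trans_lt (ENNReal.mul_lt_top ENNReal.ofReal_lt_top hKtop)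
  · rw [← tendsto_add_atTop_iff_nat 1]
    refine tendsto_of_tendsto_of_tendsto_of_le_of_le tendsto_const_nhds ?_ (fun _ => zero_le)
      hbound
    have h1 : Tendsto (fun t => ENNReal.ofReal (‖S.Rop ^ (t + 1)‖ ^ 2)) atTop (𝓝 0) := by
      have h2 := (hT.tendsto_atTop_zero.comp (tendsto_add_atTop_nat 1)).pow 2
      rw [zero_pow two_ne_zero] at h2
      exact ENNReal.ofReal_zero ▸ (ENNReal.continuous_ofReal.tendsto 0).comp h2
    simpa using ENNReal.Tendsto.mul_const h1 (Or.inr hKtop.ne)
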